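/- **Graphs.** All graphs are finite and simple. A graph is *diamond-free* if it has no induced copy of $K_4-e$. A *multisun* is a diamond-free graph $G$ of odd order such that the maximal cliques of $G$ of size $2$ are exactly the edges of a Hamiltonian cycle $C$ of $G$ (the *rim*), all the other maximal cliques (the *inscribed cliques*) consist of vertices that are pairwise nonconsecutive on $C$, and there is at least one inscribed clique. A *sub-multisun* of $G$ is a graph obtained from $G$ by removing the edge sets of some (possibly none, but not all) of its inscribed cliques. A multisun *hereditarily* satisfies a property if it and all of its sub-multisuns satisfy it. A multisun is *HOH-free* if it hereditarily has no odd hole, i.e. no induced cycle of odd length at least $4$. **N-conditions.** For inscribed cliques $A,B$ (not necessarily distinct), an *$AB$-path* is a subpath of $C$ with two distinct endpoints, one in $A$ and the other in $B$, whose inner vertices lie in no inscribed clique; an *$A$-path* is an $AA$-path. A multisun $G$ satisfies the *N-conditions* if there is a vertex $\xi$ such that: 1. every $A$-path has an even number, at least $4$, of vertices, for every inscribed clique $A$; 2. every inscribed clique has an odd number of vertices; 3. $\xi$ belongs to every inscribed clique, and $A\cap B=\{\xi\}$ for any two distinct inscribed cliques $A,B$; 4. every $AB$-path whose endpoint in $B$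 is $\xi$ has an even number of vertices; 5. every $AB$-path with $A\neq B$, neither endpoint of which is $\xi$, has an odd number of vertices. A *sunoid* is a multisun that hereditarily satisfies the N-conditions. **Words.** Consider words over an alphabet consisting of two special symbols $\epsilon$, $\sigma$ and of further letters $x_0,x_1,x_2,\dots$. The *pattern* $\pi(w)$ of a word $w$ is obtained from $w$ by repeatedly deleting intervals $\epsilon\epsilon$ until no such interval is left. Write $u\approx v$ if $\pi(u)$ and $\pi(v)$ agree up to a cyclic shift and a reversal; the class of $w$ is denoted by $[w]$. Let $G$ be a multisun that satisfies the N-conditions, and assign distinct letters $x_i$ to its inscribed cliques. Label a vertex by $\sigma$ if it lies in more than one inscribed clique, by the letter of $A$ if $A$ is the only inscribed clique containing it, and by $\epsilon$ if it lies in no inscribed clique. Let $w_G$ be the word of the labels met when the rim is traversed once, in either direction, from any vertex whose label is not $\epsilon$. The *$s$-word* of $G$ is the class $[w_G]$, which does not depend on these choices of starting vertex and direction. A *sunword* is the $s$-word of some sunoid (for some assignment of distinct letters to its inscribed cliques). **Theorem.** Let $G$ be a multisun, and assign distinct letters to its inscribed cliques. The following statements are equivalent: 1. $G$ is a sunoid;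 2. $G$ satisfies the N-conditions (so that its $s$-word is defined), and the $s$-word of $G$ is a sunword; 3. $G$ is HOH-free. -/

import Mathlib

open scoped SimpleGraph

namespace Multisun

/-! ### Multisuns -/

section Graphs

variable {V : Type*}

/-- `A` is an inclusion-wise maximal clique of `G`. -/
def IsMaxClique (G : SimpleGraph V) (A : Set V) : Prop :=
  Maximal (fun s : Set V => G.IsClique s) A

/-- The diamond `K₄ - e`. -/
def diamond : SimpleGraph (Fin 4) :=
  (⊤ : SimpleGraph (Fin 4)).deleteEdges {s(0, 1)}

/-- `G` has no induced copy of the diamond. -/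
def DiamondFree (G : SimpleGraph V) : Prop :=
  ¬ diamond ⊴ G

/-- The graph on `V` whose edges are the maximal cliques of `G` of size two. -/
def rim (G : SimpleGraph V) : SimpleGraph V where
  Adj u v := u ≠ v ∧ IsMaxClique G {u, v}
  symm := ⟨fun u v h => ⟨h.1.symm, by rw [Set.pair_comm]; exact h.2⟩⟩
  loopless := ⟨fun _ h => h.1 rfl⟩

/-- The inscribed cliques: the maximal cliques that are not of size two. -/
def IsInscribed (G : SimpleGraph V) (A : Set V) : Prop :=
  IsMaxClique G A ∧ A.ncard ≠ 2

/-- A multisun: a diamond-free graph of odd order whose maximal cliques of size two form a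
Hamiltonian cycle, the other maximal cliques, of which there is at least one, being made of
vertices that are pairwise nonconsecutive on that cycle. -/
structure IsMultisun [Fintype V] (G : SimpleGraph V) : Prop where
  diamondFree : DiamondFree G
  odd_card : Odd (Fintype.card V)
  three_le_card : 3 ≤ Fintype.card V
  rim_cycle : Nonempty (SimpleGraph.cycleGraph (Fintype.card V) ≃g rim G)
  nonconsecutive : ∀ A, IsInscribed G A → ∀ u ∈ A, ∀ v ∈ A, ¬ (rim G).Adj u v
  exists_inscribed : ∃ A, IsInscribed G A

/-- `G'` arises from `G` by removing the edge sets of some (possibly none, but not all) of the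
inscribed cliques of `G`. -/
def IsSubMultisun (G' G : SimpleGraph V) : Prop :=
  ∃ D : Set (Set V), (∀ A ∈ D, IsInscribed G A) ∧ (∃ A, IsInscribed G A ∧ A ∉ D) ∧
    G' = G.deleteEdges {e | ∃ A ∈ D, ∀ v ∈ e, v ∈ A}

/-- `G` and all its sub-multisuns satisfy `P`. -/
def Hereditarily (P : SimpleGraph V → Prop) (G : SimpleGraph V) : Prop :=
  P G ∧ ∀ G', IsSubMultisun G' G → P G'

/-- `G` has no induced odd cycle of length at least four. -/
def OddHoleFree (G : SimpleGraph V) : Prop :=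
  ∀ n : ℕ, 4 ≤ n → Odd n → ¬ SimpleGraph.cycleGraph n ⊴ G

/-- HOH-free multisuns. -/
def IsHOHFree [Fintype V] (G : SimpleGraph V) : Prop :=
  IsMultisun G ∧ Hereditarily OddHoleFree G

/-! ### The N-conditions -/

/-- `p` is an `AB`-path: a subpath of the rim with distinct endpoints, one in `A` and the other
in `B`, whose inner vertices lie in no inscribed clique. -/
def IsABPath (G : SimpleGraph V) (A B : Set V) {u v : V} (p : (rim G).Walk u v) : Prop :=
  p.IsPath ∧ u ≠ v ∧ u ∈ A ∧ v ∈ B ∧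
    ∀ w ∈ p.support, w ≠ u → w ≠ v → ∀ X, IsInscribed G X → w ∉ X

/-- The N-conditions. The number of vertices of a path `p` is `p.support.length`. If there is only
one inscribed clique, then `ξ` may be any of its vertices, and `n4` is a case of `n1`. -/
structure NConditionsAt (G : SimpleGraph V) (ξ : V) : Prop where
  n1 : ∀ A, IsInscribed G A → ∀ (u v : V) (p : (rim G).Walk u v), IsABPath G A A p →
    Even p.support.length ∧ 4 ≤ p.support.length
  n2 : ∀ A, IsInscribed G A → Odd A.ncard
  n3_mem : ∀ A, IsInscribed G A → ξ ∈ A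
  n3_inter : ∀ A B, IsInscribed G A → IsInscribed G B → A ≠ B → A ∩ B = {ξ}
  n4 : ∀ A B, IsInscribed G A → IsInscribed G B → ξ ∈ B →
    ∀ (u : V) (p : (rim G).Walk u ξ), IsABPath G A B p → Even p.support.length
  n5 : ∀ A B, IsInscribed G A → IsInscribed G B → A ≠ B →
    ∀ (u v : V) (p : (rim G).Walk u v), u ≠ ξ → v ≠ ξ → IsABPath G A B p →
      Odd p.support.length

/-- `G` satisfies the N-conditions. -/
def NConditions (G : SimpleGraph V) : Prop :=
  ∃ ξ : V, NConditionsAt G ξ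

/-- Sunoids: the multisuns that hereditarily satisfy the N-conditions. -/
def IsSunoid [Fintype V] (G : SimpleGraph V) : Prop :=
  IsMultisun G ∧ Hereditarily NConditions G

end Graphs

/-! ### Words -/

/-- The alphabet: the special symbol `ε`, the letter `σ`, and a supply of letters
`letter 0, letter 1, …` that serve as labels of inscribed cliques. -/
inductive Letter : Type
  | eps : Letter
  | sigma : Letter
  | letter : ℕ → Letter

/-- Put `x` in front of a word, cancelling `εε`. -/
def consReduce : Letter → List Letter → List Letter
  | Letter.eps, Letter.eps :: w => w
  | x, w => x :: w

/-- The pattern `π(w)`: what remains of `w` once every occurrence of `εε` has been deleted, until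
no further deletion is possible. -/
def pattern (w : List Letter) : List Letter :=
  w.foldr consReduce []

/-- `u ∼ v`: the words agree up to a cyclic shift and a reversal. -/
def DihedralEquiv (u v : List Letter) : Prop :=
  u.IsRotated v ∨ u.reverse.IsRotated v

/-- `u ≈ v`: the patterns agree up to a cyclic shift and a reversal. -/
def CyclicEquiv (u v : List Letter) : Prop :=
  DihedralEquiv (pattern u) (pattern v)

section SWords

variable {V : Type*}

open Classical in
/-- The canonical labelling, where `name A` is the letter assigned to the inscribed clique `A`:
`σ` for a vertex in more than one inscribed clique, the letter of `A` for a vertex in the unique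
inscribed clique `A`, and `ε` for a vertex in no inscribed clique. -/
noncomputable def canonicalLabel (G : SimpleGraph V) (name : Set V → ℕ) (v : V) : Letter :=
  if ∃ A B, IsInscribed G A ∧ IsInscribed G B ∧ A ≠ B ∧ v ∈ A ∧ v ∈ B then Letter.sigma
  else if h : ∃ A, IsInscribed G A ∧ v ∈ A then Letter.letter (name h.choose)
  else Letter.eps

/-- `w` is a linear word `w_G`: the sequence of labels met when traversing the rim once, starting
from a vertex whose label is not `ε`, in one of the two directions (an isomorphism from the
standard cycle amounts to a starting vertex and an orientation). -/
def IsLinearWord [Fintype V] (G : SimpleGraph V) (name : Set V → ℕ) (w : List Letter) : Prop :=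
  w.head? ≠ some Letter.eps ∧
    ∃ φ : SimpleGraph.cycleGraph (Fintype.card V) ≃g rim G,
      w = List.ofFn fun i => canonicalLabel G name (φ i)

/-- The `s`-word of `G`, that is, the cyclic word `[w_G]`, as a class of words. It is meant for
multisuns `G` that satisfy the N-conditions; any two words `w_G` are then equivalent. -/
def sWord [Fintype V] (G : SimpleGraph V) (name : Set V → ℕ) : Set (List Letter) :=
  {u | ∃ w, IsLinearWord G name w ∧ CyclicEquiv u w}

/-- Sunwords: the `s`-words of sunoids, for any assignment of distinct letters to the inscribed
cliques of the sunoid. -/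
def IsSunword (c : Set (List Letter)) : Prop :=
  ∃ (n : ℕ) (H : SimpleGraph (Fin n)) (name : Set (Fin n) → ℕ),
    IsSunoid H ∧ Set.InjOn name {A | IsInscribed H A} ∧ c = sWord H name

end SWords

end Multisun

/-!
# Sunoids, sunwords and multisuns without odd holes

Let `R` be the rim of a multisun, `n` its odd order, and `F` the family of its inscribed cliques.
Diamond-freeness means that two members of `F` share at most one vertex and that every triangle
lies in one of them (`CliqueSystem`). In this form the sub-multisuns are simply the graphs
`withCliques R F'` with `F'` a nonempty subfamily of `F`, and their rim and inscribed cliques are `R`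
and `F'`. An arc of the rim that is admissible for a subfamily is admissible for the one or two
cliques that contain its endpoints, so the N-conditions hold hereditarily if and only if they hold
in the strong form in which the inner vertices of an arc need only avoid those one or two cliques
(`StrongArcConditions`, `IsMultisun.isSunoid_iff`).

*From no odd holes to the N-conditions.* An arc between consecutive vertices of `A` closes up with
an edge of `A` to a hole, so it has odd length; summing up, `|A|` has the parity of `n`. An arc from
`A` to `B` avoiding the common vertex `ξ` closes up through `ξ`, so it has even length. If `A` and
`B` were disjoint, two arcs between them without a common endpoint would close up through `A` and
`B` to a hole, whence their lengths have the same parity; this extends to arcs with a common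
endpoint by comparison with a third arc. Then the lengths of all arcs around the rim add up to an
even number, although `n` is odd (`exists_mem_mem_of_oddHoleFree`). So cliques meet pairwise, and
the triangle property yields a vertex common to all of them.

*From the N-conditions to no odd holes.* Let the rim be traversed from `ξ`. The strong N-conditions
imply that any two cliques are interlaced (`Interlaced`): for `a ∈ A` and `b ∈ B` other than `ξ`, the
number of vertices of `B` before `a` and the number of vertices of `A` before `b` have different
parities. A hole with edges in three cliques `A`, `B`, `C` avoids `ξ`, and along it the parity of the
number of preceding vertices of `C` changes nowhere outside `C`. The resulting six parities
contradict the interlacing of the three pairs (`CycParam.not_three_chords`). A hole with edges in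
one or two cliques consists of one or two arcs and a few edges, and has even length by the
N-conditions.

*Words.* Conversely, interlacing together with the N-conditions of the multisun itself implies the
strong N-conditions (`ArcConditions.strong`). Interlacing does not involve the vertices outside all
cliques, so it can be read off from the word of the labels with every `ε` deleted. That shorter word
is determined by the pattern up to rotation and reversal, hence interlacing passes from a sunoid to
any multisun with the same `s`-word (`IsMultisun.isSunoid_of_sWord_eq`).
-/


namespace Multisun

/-! ### Cyclic parametrizations -/

section Param

variable {V : Type*} {G : SimpleGraph V} {m : ℕ} {f : ℤ → V}

/-- `f` winds the integers around an induced cycle of length `m` of `G`. Indexing by `ℤ` makes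
rotations and reflections of the cycle mere substitutions in the argument of `f`. -/
structure CycParam (G : SimpleGraph V) (m : ℕ) (f : ℤ → V) : Prop where
  eq_iff : ∀ s t, f s = f t ↔ (m : ℤ) ∣ t - s
  adj_iff : ∀ s t, G.Adj (f s) (f t) ↔ (m : ℤ) ∣ t - s - 1 ∨ (m : ℤ) ∣ s - t - 1

theorem int_eq_zero_of_dvd_of_lt {m x : ℤ} (h : m ∣ x) (h1 : -m < x) (h2 : x < m) : x = 0 :=
  Int.eq_zero_of_abs_lt_dvd h (abs_lt.2 ⟨h1, h2⟩)

theorem int_eq_of_dvd_of_lt {m x : ℤ} (h : m ∣ x) (h1 : 0 < x) (h2 : x < 2 * m) : x = m := by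
  have := int_eq_zero_of_dvd_of_lt (x := x - m) (m := m) (dvd_sub_self_right.2 h) (by omega)
    (by omega)
  omega

theorem CycParam.shift (h : CycParam G m f) (c : ℤ) : CycParam G m fun t => f (c + t) :=
  ⟨fun s t => by simp [h.eq_iff], fun s t => by simp [h.adj_iff]⟩

theorem CycParam.flip (h : CycParam G m f) (c : ℤ) : CycParam G m fun t => f (c - t) := by
  refine ⟨fun s t => ?_, fun s t => ?_⟩
  · rw [h.eq_iff, ← dvd_neg]; ring_nf
  · rw [h.adj_iff, or_comm]; ring_nf

theorem CycParam.add_period (h : CycParam G m f) (t : ℤ) : f (t + m) = f t :=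
  ((h.eq_iff _ _).2 (by simp)).symm

theorem CycParam.adj_succ (h : CycParam G m f) (t : ℤ) : G.Adj (f t) (f (t + 1)) :=
  (h.adj_iff _ _).2 (Or.inl (by simp))

theorem CycParam.ne (h : CycParam G m f) {s t : ℤ} (h1 : s < t) (h2 : t < s + m) :
    f s ≠ f t := fun e => by
  have := int_eq_zero_of_dvd_of_lt ((h.eq_iff _ _).1 e) (by omega) (by omega)
  omega

theorem CycParam.eq_of_eq (h : CycParam G m f) {s t : ℤ} (e : f s = f t) (h1 : s < t + m)
    (h2 : t < s + m) : s = t := by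
  have := int_eq_zero_of_dvd_of_lt ((h.eq_iff _ _).1 e) (by omega) (by omega)
  omega

/-- Adjacency of two vertices of the cycle less than one turn apart. -/
theorem CycParam.adj_iff_of_lt (h : CycParam G m f) {s t : ℤ} (h1 : s < t) (h2 : t < s + m) :
    G.Adj (f s) (f t) ↔ t = s + 1 ∨ t + 1 = s + m := by
  rw [h.adj_iff]
  constructor
  · rintro (h3 | h3)
    · left
      have := int_eq_zero_of_dvd_of_lt h3 (by omega) (by omega)
      omega
    · right
      have := int_eq_of_dvd_of_lt ((dvd_neg (a := (m : ℤ))).2 h3) (by omega) (by omega)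
      omega
  · rintro (rfl | h3)
    · left; simp
    · right
      rw [show s - t - 1 = -(m : ℤ) by omega]
      exact (dvd_neg).2 dvd_rfl

theorem CycParam.eq_or_eq_of_adj (h : CycParam G m f) (hs : Function.Surjective f) {s : ℤ} {v : V}
    (hv : G.Adj (f s) v) : v = f (s + 1) ∨ v = f (s - 1) := by
  obtain ⟨t, rfl⟩ := hs v
  rcases (h.adj_iff _ _).1 hv with h1 | h1
  · left
    exact ((h.eq_iff _ _).2 (by rwa [show t - (s + 1) = t - s - 1 by ring])).symm
  · right
    exact ((h.eq_iff _ _).2 (by rwa [show s - 1 - t = s - t - 1 by ring]))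

theorem CycParam.surjective_shift (hs : Function.Surjective f) (c : ℤ) :
    Function.Surjective fun t => f (c + t) := fun v => by
  obtain ⟨t, rfl⟩ := hs v
  exact ⟨t - c, by simp⟩

theorem CycParam.surjective_flip (hs : Function.Surjective f) (c : ℤ) :
    Function.Surjective fun t => f (c - t) := fun v => by
  obtain ⟨t, rfl⟩ := hs v
  exact ⟨c - t, by simp⟩

/-- Every vertex of the cycle is met within one turn from any given position. -/
theorem CycParam.exists_lt (h : CycParam G m f) (hm : 0 < m) (e t : ℤ) :
    ∃ k : ℕ, k < m ∧ f (e + k) = f t := by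
  have h0 := Int.emod_nonneg (t - e) (b := (m : ℤ)) (by omega)
  have h1 := Int.emod_lt_of_pos (t - e) (b := (m : ℤ)) (by omega)
  refine ⟨((t - e) % m).toNat, by omega, ?_⟩
  rw [Int.toNat_of_nonneg h0, h.eq_iff, ← sub_sub]
  exact Int.dvd_self_sub_emod

theorem CycParam.exists_nat (h : CycParam G m f) (hm : 0 < m) (hs : Function.Surjective f) (v : V) :
    ∃ p : ℕ, p < m ∧ f p = v := by
  obtain ⟨t, rfl⟩ := hs v
  obtain ⟨k, hk, hkt⟩ := h.exists_lt hm 0 t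
  exact ⟨k, hk, by simpa using hkt⟩

/-- A sequence of vertices that follows the edges of a cycle without turning back runs along the
cycle at unit speed, in one of the two directions. -/
theorem CycParam.exists_eq_of_path (h : CycParam G m f) (hs : Function.Surjective f)
    {g : ℕ → V} {d : ℕ} (hadj : ∀ t < d, G.Adj (g t) (g (t + 1)))
    (hne : ∀ t, t + 2 ≤ d → g t ≠ g (t + 2)) :
    ∃ r : ℤ → V, CycParam G m r ∧ Function.Surjective r ∧ (∀ t : ℕ, t ≤ d → r t = g t) ∧
      ∃ c : ℤ, (r = fun t => f (c + t)) ∨ (r = fun t => f (c - t)) := by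
  obtain ⟨c, hc⟩ := hs (g 0)
  obtain ⟨r, hr, hrs, h0, h1, hrc⟩ : ∃ r : ℤ → V, CycParam G m r ∧ Function.Surjective r ∧
      r 0 = g 0 ∧ (1 ≤ d → r 1 = g 1) ∧
      ∃ c : ℤ, (r = fun t => f (c + t)) ∨ (r = fun t => f (c - t)) := by
    by_cases hd : 1 ≤ d
    · have h2 := hadj 0 (by omega)
      rw [← hc] at h2
      rcases h.eq_or_eq_of_adj hs h2 with h3 | h3
      · exact ⟨_, h.shift c, CycParam.surjective_shift hs c, by simpa using hc,
          fun _ => h3.symm, c, Or.inl rfl⟩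
      · exact ⟨_, h.flip c, CycParam.surjective_flip hs c, by simpa using hc,
          fun _ => h3.symm, c, Or.inr rfl⟩
    · exact ⟨_, h.shift c, CycParam.surjective_shift hs c, by simpa using hc,
          fun h => absurd h hd, c, Or.inl rfl⟩
  refine ⟨r, hr, hrs, fun t => ?_, hrc⟩
  induction t using Nat.strong_induction_on with
  | _ t ih =>
    intro ht
    match t, ih, ht with
    | 0, _, _ => simpa using h0
    | 1, _, ht => simpa using h1 ht
    | t + 2, ih, ht =>
      have h2 := hadj (t + 1) (by omega)
      rw [← ih (t + 1) (by omega) (by omega)] at h2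
      rcases hr.eq_or_eq_of_adj hrs h2 with h3 | h3
      · rw [show t + 2 = t + 1 + 1 from rfl, h3]
        push_cast
        rfl
      · exfalso
        apply hne t ht
        rw [← ih t (by omega) (by omega), show t + 2 = t + 1 + 1 from rfl, h3]
        congr 1
        push_cast
        ring

theorem cycleGraph_isIndContained_of {g : ℕ → V} (hinj : ∀ s t, s < t → t < m → g s ≠ g t)
    (hadj : ∀ s t, s < t → t < m → (G.Adj (g s) (g t) ↔ t = s + 1 ∨ (s = 0 ∧ t + 1 = m))) :
    SimpleGraph.cycleGraph m ⊴ G := by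
  have key : ∀ a b : Fin m, a.val < b.val →
      (G.Adj (g a) (g b) ↔ (SimpleGraph.cycleGraph m).Adj a b) := by
    intro a b hab
    have := a.isLt
    have := b.isLt
    rw [hadj _ _ hab b.isLt, SimpleGraph.cycleGraph_adj', Fin.coe_sub_iff_lt.2 hab,
      Fin.coe_sub_iff_le.2 hab.le]
    omega
  refine ⟨⟨⟨fun i => g i, fun a b hab => ?_⟩, fun {a b} => ?_⟩⟩
  · rcases lt_trichotomy a.val b.val with h | h | h
    · exact absurd hab (hinj _ _ h b.isLt)
    · exact Fin.ext h
    · exact absurd hab.symm (hinj _ _ h a.isLt)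
  · change G.Adj (g a) (g b) ↔ _
    rcases lt_trichotomy a.val b.val with h | h | h
    · exact key a b h
    · rw [Fin.ext h]; simp
    · rw [SimpleGraph.adj_comm, key b a h, SimpleGraph.adj_comm]

theorem cycleGraph_embedding_param (hm : 2 ≤ m) (φ : SimpleGraph.cycleGraph m ↪g G) :
    ∃ f : ℤ → V, CycParam G m f ∧ ∀ i : Fin m, f i.val = φ i := by
  have h0 : ∀ t : ℤ, 0 ≤ t % m := fun t => Int.emod_nonneg t (by omega)
  have h1 : ∀ t : ℤ, t % m < m := fun t => Int.emod_lt_of_pos t (by omega)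
  let e : ℤ → Fin m := fun t => ⟨(t % m).toNat, by have := h0 t; have := h1 t; omega⟩
  have he : ∀ t, ((e t).val : ℤ) = t % m := fun t => Int.toNat_of_nonneg (h0 t)
  have hdvd : ∀ s t : ℤ, (m : ℤ) ∣ t - s ↔ s % m = t % m := fun s t => by
    rw [← Int.emod_emod_of_dvd s dvd_rfl, ← Int.modEq_iff_dvd]; simp [Int.ModEq]
  have hsub : ∀ s t : ℤ, (e t - e s).val = 1 ↔ (m : ℤ) ∣ t - s - 1 := by
    intro s t
    have e1 : t - s - 1 = (t % m - s % m - 1) + m * (t / m - s / m) := by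
      have := Int.emod_add_mul_ediv t m
      have := Int.emod_add_mul_ediv s m
      linear_combination this - Int.emod_add_mul_ediv t m
    rw [e1, dvd_add_left (dvd_mul_right _ _)]
    have hs := he s
    have ht := he t
    have := h0 s
    have := h0 t
    have := h1 s
    have := h1 t
    by_cases hst : (e s).val ≤ (e t).val
    · rw [Fin.coe_sub_iff_le.2 hst]
      constructor
      · intro h
        rw [show t % m - s % m - 1 = 0 by omega]
        exact dvd_zero _
      · intro h
        have := int_eq_zero_of_dvd_of_lt h (by omega) (by omega)
        omega
    · rw [Fin.coe_sub_iff_lt.2 (not_le.1 hst)]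
      constructor
      · intro h
        rw [show t % m - s % m - 1 = -(m : ℤ) by omega]
        exact (dvd_neg).2 dvd_rfl
      · intro h
        have := int_eq_of_dvd_of_lt ((dvd_neg (a := (m : ℤ))).2 h) (by omega) (by omega)
        omega
  refine ⟨fun t => φ (e t), ⟨fun s t => ?_, fun s t => ?_⟩, fun i => ?_⟩
  · rw [φ.injective.eq_iff, hdvd, Fin.ext_iff, ← he s, ← he t]
    omega
  · rw [SimpleGraph.Embedding.map_adj_iff, SimpleGraph.cycleGraph_adj', hsub, hsub, or_comm]
  · refine congrArg φ (Fin.ext ?_)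
    have := he i.val
    rw [Int.emod_eq_of_lt (by omega) (by omega)] at this
    omega

theorem CycParam.embedding (hm : 2 ≤ m) (h : CycParam G m f) :
    ∃ φ : SimpleGraph.cycleGraph m ↪g G, ∀ i, φ i = f i.val := by
  have key : ∀ a b : Fin m, a.val < b.val →
      (G.Adj (f a) (f b) ↔ (SimpleGraph.cycleGraph m).Adj a b) := by
    intro a b hab
    have := a.isLt
    have := b.isLt
    rw [h.adj_iff_of_lt (by omega) (by omega), SimpleGraph.cycleGraph_adj',
      Fin.coe_sub_iff_lt.2 hab, Fin.coe_sub_iff_le.2 hab.le]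
    omega
  refine ⟨⟨⟨fun i => f i.val, fun a b hab => ?_⟩, fun {a b} => ?_⟩, fun i => rfl⟩
  · exact Fin.ext (by exact_mod_cast h.eq_of_eq hab (by omega) (by omega))
  · change G.Adj (f a) (f b) ↔ _
    rcases lt_trichotomy a.val b.val with h | h | h
    · exact key a b h
    · rw [Fin.ext h]; simp
    · rw [SimpleGraph.adj_comm, key b a h, SimpleGraph.adj_comm]

/-- A quantity that agrees at any two consecutive marks agrees at all marks. -/
theorem const_of_consecutive {α : Type*} {P : ℕ → Prop} {g : ℕ → α} {N : ℕ}
    (h : ∀ i j, i < j → j ≤ N → P i → P j → (∀ t, i < t → t < j → ¬ P t) → g i = g j) :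
    ∀ i j, i ≤ j → j ≤ N → P i → P j → g i = g j := by
  suffices H : ∀ k i j, j - i ≤ k → i < j → j ≤ N → P i → P j → g i = g j by
    intro i j hij hj hi hPj
    rcases hij.eq_or_lt with rfl | hij
    · rfl
    · exact H (j - i) i j le_rfl hij hj hi hPj
  intro k
  induction k with
  | zero => intros; omega
  | succ k ih =>
    intro i j hk hij hj hi hPj
    by_cases hx : ∀ t, i < t → t < j → ¬ P t
    · exact h i j hij hj hi hPj hx
    · push Not at hx
      obtain ⟨t, h1, h2, h3⟩ := hx
      exact (ih i t (by omega) h1 (by omega) hi h3).trans (ih t j (by omega) h2 hj h3 hPj)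

end Param

/-! ### Rims with families of cliques -/

section Model

variable {V : Type*}

/-- The graph obtained from `R` by making every member of `F` a clique. -/
def withCliques (R : SimpleGraph V) (F : Set (Set V)) : SimpleGraph V where
  Adj u v := R.Adj u v ∨ (u ≠ v ∧ ∃ A ∈ F, u ∈ A ∧ v ∈ A)
  symm := ⟨fun _ _ h => h.imp (fun h => h.symm)
    fun ⟨h, A, hA, hu, hv⟩ => ⟨h.symm, A, hA, hv, hu⟩⟩
  loopless := ⟨fun _ h => h.elim (fun h => h.ne rfl) fun h => h.1 rfl⟩

theorem withCliques_adj {R : SimpleGraph V} {F : Set (Set V)} {u v : V} :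
    (withCliques R F).Adj u v ↔ R.Adj u v ∨ (u ≠ v ∧ ∃ A ∈ F, u ∈ A ∧ v ∈ A) := Iff.rfl

/-- What is needed of `R` and `F` for `R` to be the rim and `F` the family of inscribed cliques of
`withCliques R F`. Maximal cliques are not mentioned, so that the property passes to subfamilies of
`F` without further ado. -/
structure CliqueSystem (R : SimpleGraph V) (F : Set (Set V)) : Prop where
  three_le : ∀ A ∈ F, 3 ≤ A.ncard
  indep : ∀ A ∈ F, ∀ u ∈ A, ∀ v ∈ A, ¬ R.Adj u v
  linear : ∀ A ∈ F, ∀ B ∈ F, ∀ u v, u ≠ v → u ∈ A → u ∈ B → v ∈ A → v ∈ B → A = B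
  triangle : ∀ u v w, (withCliques R F).Adj u v → (withCliques R F).Adj v w →
    (withCliques R F).Adj u w → ∃ A ∈ F, u ∈ A ∧ v ∈ A ∧ w ∈ A

theorem withCliques_mono {R : SimpleGraph V} {F F' : Set (Set V)} (h : F' ⊆ F) {u v : V}
    (ha : (withCliques R F').Adj u v) : (withCliques R F).Adj u v :=
  ha.imp_right fun ⟨hne, A, hA, h'⟩ => ⟨hne, A, h hA, h'⟩

theorem CliqueSystem.mono {R : SimpleGraph V} {F F' : Set (Set V)} (h : CliqueSystem R F)
    (hF : F' ⊆ F) : CliqueSystem R F' where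
  three_le A hA := h.three_le A (hF hA)
  indep A hA := h.indep A (hF hA)
  linear A hA B hB := h.linear A (hF hA) B (hF hB)
  triangle u v w huv hvw huw := by
    obtain ⟨A, hA, hu, hv, hw⟩ := h.triangle u v w (withCliques_mono hF huv)
      (withCliques_mono hF hvw) (withCliques_mono hF huw)
    rcases huv with h1 | ⟨hne, B, hB, hu', hv'⟩
    · exact absurd h1 (h.indep A hA u hu v hv)
    · rw [h.linear A hA B (hF hB) u v hne hu hu' hv hv'] at hw
      exact ⟨B, hB, hu', hv', hw⟩

/-- In a family of cliques with the triangle property, two adjacent vertices of `A` force every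
common neighbour into `A`. -/
theorem CliqueSystem.mem_of_adj {R : SimpleGraph V} {F : Set (Set V)} (h : CliqueSystem R F)
    {A : Set V} (hA : A ∈ F) {u v w : V} (hne : u ≠ v) (hu : u ∈ A) (hv : v ∈ A)
    (huw : (withCliques R F).Adj u w) (hvw : (withCliques R F).Adj v w) : w ∈ A := by
  obtain ⟨B, hB, hu', hv', hw⟩ := h.triangle u v w (Or.inr ⟨hne, A, hA, hu, hv⟩) hvw huw
  rwa [h.linear A hA B hB u v hne hu hu' hv hv']

/-- The family and the rim of a clique system are recovered from its graph: here the family, in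
`CliqueSystem.rim_eq` the rim. -/
theorem CliqueSystem.isInscribed_iff [Finite V] {R : SimpleGraph V} {F : Set (Set V)}
    (h : CliqueSystem R F) (hR : ∀ v, ∃ w, R.Adj v w) (hF : F.Nonempty) (A : Set V) :
    IsInscribed (withCliques R F) A ↔ A ∈ F := by
  constructor
  · rintro ⟨hmax, hcard⟩
    have hcl : (withCliques R F).IsClique A := hmax.prop
    have hmem : ∀ B, A ⊆ B → (withCliques R F).IsClique B → B = A := fun B hAB hB =>
      (hAB.antisymm (hmax.le_of_ge hB hAB)).symm
    have h3 : 3 ≤ A.ncard := by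
      by_contra hlt
      have hlt' : A.ncard = 0 ∨ A.ncard = 1 := by omega
      rcases hlt' with h0 | h1
      · rw [Set.ncard_eq_zero] at h0
        subst h0
        obtain ⟨B, hB⟩ := hF
        have := h.three_le B hB
        obtain ⟨v, -⟩ := Set.nonempty_of_ncard_ne_zero (s := B) (by omega)
        have := hmem {v} (Set.empty_subset _) (by simp)
        exact Set.singleton_ne_empty v this
      · obtain ⟨v, rfl⟩ := Set.ncard_eq_one.1 h1
        obtain ⟨w, hw⟩ := hR v
        have := hmem {v, w} (by simp) (by
          rw [SimpleGraph.isClique_pair]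
          exact fun _ => Or.inl hw)
        have hwv : w ∈ ({v} : Set V) := this ▸ (by simp)
        exact hw.ne (Set.mem_singleton_iff.1 hwv).symm
    obtain ⟨u, v, w, hu, hv, hw, huv, huw, hvw⟩ := (Set.two_lt_ncard_iff).1 h3
    obtain ⟨B, hB, hu', hv', -⟩ := h.triangle u v w (hcl hu hv huv) (hcl hv hw hvw)
      (hcl hu hw huw)
    have hBcl : (withCliques R F).IsClique B := fun x hx y hy hxy =>
      Or.inr ⟨hxy, B, hB, hx, hy⟩
    have hAB : A ⊆ B := fun x hx => by
      by_cases hxu : x = u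
      · exact hxu ▸ hu'
      by_cases hxv : x = v
      · exact hxv ▸ hv'
      exact h.mem_of_adj hB huv hu' hv' (hcl hu hx (Ne.symm hxu)) (hcl hv hx (Ne.symm hxv))
    rwa [← hmem B hAB hBcl]
  · intro hA
    have h3 := h.three_le A hA
    refine ⟨⟨fun x hx y hy hxy => Or.inr ⟨hxy, A, hA, hx, hy⟩, fun B hB hAB x hx => ?_⟩, by omega⟩
    obtain ⟨u, v, w, hu, hv, hw, huv, huw, hvw⟩ := (Set.two_lt_ncard_iff).1 h3
    by_cases hxu : x = u
    · exact hxu ▸ hu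
    by_cases hxv : x = v
    · exact hxv ▸ hv
    exact h.mem_of_adj hA huv hu hv (hB (hAB hu) hx (Ne.symm hxu)) (hB (hAB hv) hx (Ne.symm hxv))

theorem CliqueSystem.rim_eq {R : SimpleGraph V} {F : Set (Set V)} (h : CliqueSystem R F) :
    rim (withCliques R F) = R := by
  ext u v
  constructor
  · rintro ⟨hne, hmax⟩
    have hcl : (withCliques R F).IsClique {u, v} := hmax.prop
    rcases hcl (by simp) (by simp) hne with h1 | ⟨-, A, hA, hu, hv⟩
    · exact h1
    · exfalso
      have hsub : A ⊆ {u, v} := hmax.le_of_ge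
        (y := A) (fun x hx y hy hxy => Or.inr ⟨hxy, A, hA, hx, hy⟩)
        (Set.insert_subset hu (Set.singleton_subset_iff.2 hv))
      have h1 := Set.ncard_le_ncard hsub
      have h2 := Set.ncard_pair hne
      have := h.three_le A hA
      omega
  · intro hadj
    refine ⟨hadj.ne, SimpleGraph.isClique_pair.2 fun _ => Or.inl hadj, ?_⟩
    intro B hB hsub x hx
    by_contra hxn
    simp only [Set.mem_insert_iff, Set.mem_singleton_iff, not_or] at hxn
    have hu := hsub (Set.mem_insert u {v})
    have hv := hsub (Set.mem_insert_of_mem u rfl)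
    obtain ⟨A, hA, hu', hv', -⟩ := h.triangle u v x (hB hu hv hadj.ne) (hB hv hx (Ne.symm hxn.2))
      (hB hu hx (Ne.symm hxn.1))
    exact h.indep A hA u hu' v hv' hadj

theorem exists_isMaxClique [Finite V] {G : SimpleGraph V} {s : Set V} (hs : G.IsClique s) :
    ∃ A, IsMaxClique G A ∧ s ⊆ A := by
  obtain ⟨A, hA, hmax⟩ := Finite.exists_le_maximal (p := fun s : Set V => G.IsClique s) hs
  exact ⟨A, hmax, hA⟩

/-- In a diamond-free graph, two maximal cliques with two common vertices coincide. -/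
theorem DiamondFree.eq_of_common {G : SimpleGraph V} (hG : DiamondFree G) {A B : Set V}
    (hA : IsMaxClique G A) (hB : IsMaxClique G B) {u v : V} (huv : u ≠ v) (huA : u ∈ A)
    (huB : u ∈ B) (hvA : v ∈ A) (hvB : v ∈ B) : A = B := by
  have hsub : A ⊆ B := by
    intro x hx
    by_contra hxB
    have hAcl : G.IsClique A := hA.prop
    have hBcl : G.IsClique B := hB.prop
    obtain ⟨y, hy, hxy⟩ : ∃ y ∈ B, ¬ G.Adj x y := by
      by_contra! hcon
      exact hxB (hB.le_of_ge (y := insert x B)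
        (SimpleGraph.IsClique.insert hBcl fun y hy _ => hcon y hy)
        (Set.subset_insert x B) (Set.mem_insert x B))
    have hxu : x ≠ u := fun e => hxB (e ▸ huB)
    have hxv : x ≠ v := fun e => hxB (e ▸ hvB)
    have hyu : y ≠ u := fun e => hxy (e ▸ hAcl hx huA hxu)
    have hyv : y ≠ v := fun e => hxy (e ▸ hAcl hx hvA hxv)
    have hxy' : x ≠ y := fun e => hxB (e ▸ hy)
    have a1 := hAcl hx huA hxu
    have a2 := hAcl hx hvA hxv
    have a3 := hBcl hy huB hyu
    have a4 := hBcl hy hvB hyv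
    have a5 := hAcl huA hvA huv
    refine hG ⟨⟨⟨![x, y, u, v], ?_⟩, ?_⟩⟩
    · intro i j hij
      fin_cases i <;> fin_cases j <;> simp_all
    · intro i j
      change G.Adj (![x, y, u, v] i) (![x, y, u, v] j) ↔ _
      fin_cases i <;> fin_cases j <;>
        simp [diamond, a1, a2, a3, a4, a5, a1.symm, a2.symm, a3.symm, a4.symm, a5.symm, hxy,
          mt SimpleGraph.Adj.symm hxy]
  exact hsub.antisymm (hA.le_of_ge hB.prop hsub)

theorem adj_of_rim {G : SimpleGraph V} {u v : V} (h : (rim G).Adj u v) : G.Adj u v :=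
  h.2.prop (by simp) (by simp) h.1

variable [Fintype V] {G : SimpleGraph V}

theorem IsMultisun.exists_param (hG : IsMultisun G) :
    ∃ r : ℤ → V, CycParam (rim G) (Fintype.card V) r ∧ Function.Surjective r := by
  obtain ⟨φ⟩ := hG.rim_cycle
  have := hG.three_le_card
  obtain ⟨r, hr, hφ⟩ := cycleGraph_embedding_param (by omega) φ.toEmbedding
  refine ⟨r, hr, fun v => ⟨(φ.symm v).val, ?_⟩⟩
  rw [hφ]
  exact φ.apply_symm_apply v

theorem IsMultisun.exists_rim_adj (hG : IsMultisun G) (v : V) : ∃ w, (rim G).Adj v w := by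
  obtain ⟨r, hr, hs⟩ := hG.exists_param
  obtain ⟨t, rfl⟩ := hs v
  exact ⟨_, hr.adj_succ t⟩

theorem IsMultisun.eq_withCliques (G : SimpleGraph V) :
    G = withCliques (rim G) {A | IsInscribed G A} := by
  ext u v
  constructor
  · intro h
    obtain ⟨A, hA, hsub⟩ := exists_isMaxClique (G := G) (s := {u, v})
      (by rw [SimpleGraph.isClique_pair]; exact fun _ => h)
    have hu := hsub (Set.mem_insert u {v})
    have hv := hsub (Set.mem_insert_of_mem u rfl)
    by_cases h2 : A.ncard = 2
    · left
      have : {u, v} = A := Set.eq_of_subset_of_ncard_le hsub (by rw [h2, Set.ncard_pair h.ne])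
      exact ⟨h.ne, this ▸ hA⟩
    · exact Or.inr ⟨h.ne, A, ⟨hA, h2⟩, hu, hv⟩
  · rintro (h | ⟨hne, A, hA, hu, hv⟩)
    · exact adj_of_rim h
    · exact hA.1.prop hu hv hne

theorem IsMultisun.cliqueSystem (hG : IsMultisun G) :
    CliqueSystem (rim G) {A | IsInscribed G A} where
  three_le A hA := by
    by_contra hlt
    have h2 := hA.2
    have hlt' : A.ncard = 0 ∨ A.ncard = 1 := by omega
    have hmem : ∀ B, A ⊆ B → G.IsClique B → B = A := fun B hAB hB =>
      (hAB.antisymm (hA.1.le_of_ge hB hAB)).symm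
    rcases hlt' with h0 | h1
    · rw [Set.ncard_eq_zero] at h0
      subst h0
      have := hG.three_le_card
      obtain ⟨v⟩ : Nonempty V := Fintype.card_pos_iff.1 (by omega)
      exact Set.singleton_ne_empty v (hmem {v} (Set.empty_subset _) (by simp))
    · obtain ⟨v, rfl⟩ := Set.ncard_eq_one.1 h1
      obtain ⟨w, hw⟩ := hG.exists_rim_adj v
      have := hmem {v, w} (by simp) hw.2.prop
      have hwv : w ∈ ({v} : Set V) := this ▸ (by simp)
      exact hw.ne (Set.mem_singleton_iff.1 hwv).symm
  indep A hA := hG.nonconsecutive A hA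
  linear A hA B hB u v huv huA huB hvA hvB :=
    hG.diamondFree.eq_of_common hA.1 hB.1 huv huA huB hvA hvB
  triangle u v w huv hvw huw := by
    rw [← IsMultisun.eq_withCliques G] at huv hvw huw
    have hcl : G.IsClique {u, v, w} := by
      intro x hx y hy hxy
      simp only [Set.mem_insert_iff, Set.mem_singleton_iff] at hx hy
      rcases hx with rfl | rfl | rfl <;> rcases hy with rfl | rfl | rfl <;>
        first | exact absurd rfl hxy | assumption | (apply SimpleGraph.Adj.symm; assumption)
    obtain ⟨A, hA, hsub⟩ := exists_isMaxClique hcl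
    refine ⟨A, ⟨hA, fun h2 => ?_⟩, hsub (by simp), hsub (by simp), hsub (by simp)⟩
    have h3 : 2 < A.ncard := (Set.two_lt_ncard_iff).2
      ⟨u, v, w, hsub (by simp), hsub (by simp), hsub (by simp), huv.ne, huw.ne, hvw.ne⟩
    omega

theorem IsMultisun.isSubMultisun_iff (hG : IsMultisun G) (G' : SimpleGraph V) :
    IsSubMultisun G' G ↔
      ∃ F ⊆ {A | IsInscribed G A}, F.Nonempty ∧ G' = withCliques (rim G) F := by
  have hS := hG.cliqueSystem
  have key : ∀ D ⊆ {A | IsInscribed G A}, G.deleteEdges {e | ∃ A ∈ D, ∀ v ∈ e, v ∈ A} =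
      withCliques (rim G) ({A | IsInscribed G A} \ D) := by
    intro D hD
    ext u v
    have hadj : G.Adj u v ↔ (rim G).Adj u v ∨ (u ≠ v ∧ ∃ A, IsInscribed G A ∧ u ∈ A ∧ v ∈ A) := by
      conv_lhs => rw [IsMultisun.eq_withCliques G]
      rfl
    rw [SimpleGraph.deleteEdges_adj, hadj]
    simp only [withCliques_adj, Set.mem_ofPred_eq, Sym2.mem_iff, forall_eq_or_imp, forall_eq,
      not_exists, not_and, Set.mem_sdiff]
    constructor
    · rintro ⟨h | ⟨hne, A, hA, hu, hv⟩, h2⟩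
      · exact Or.inl h
      · exact Or.inr ⟨hne, A, ⟨hA, fun hAD => h2 A hAD hu hv⟩, hu, hv⟩
    · rintro (h | ⟨hne, A, ⟨hA, hAD⟩, hu, hv⟩)
      · exact ⟨Or.inl h, fun B hB hu hv => hG.nonconsecutive B (hD hB) u hu v hv h⟩
      · refine ⟨Or.inr ⟨hne, A, hA, hu, hv⟩, fun B hB hu' hv' => hAD ?_⟩
        rwa [hS.linear A hA B (hD hB) u v hne hu hu' hv hv']
  constructor
  · rintro ⟨D, hD, ⟨A, hA, hAD⟩, rfl⟩
    exact ⟨_, Set.sdiff_subset, ⟨A, hA, hAD⟩, key D hD⟩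
  · rintro ⟨F, hF, ⟨A, hA⟩, rfl⟩
    refine ⟨{A | IsInscribed G A} \ F, fun B hB => hB.1, ⟨A, hF hA, fun h => h.2 hA⟩, ?_⟩
    rw [key _ Set.sdiff_subset, Set.sdiff_sdiff_cancel_left hF]

theorem IsMultisun.hereditarily_iff (hG : IsMultisun G) (P : SimpleGraph V → Prop) :
    Hereditarily P G ↔
      ∀ F ⊆ {A | IsInscribed G A}, F.Nonempty → P (withCliques (rim G) F) := by
  constructor
  · rintro ⟨-, h⟩ F hF hne
    exact h _ ((hG.isSubMultisun_iff _).2 ⟨F, hF, hne, rfl⟩)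
  · intro h
    refine ⟨?_, fun G' hG' => ?_⟩
    · rw [IsMultisun.eq_withCliques G]
      exact h _ subset_rfl hG.exists_inscribed
    · obtain ⟨F, hF, hne, rfl⟩ := (hG.isSubMultisun_iff _).1 hG'
      exact h F hF hne

end Model

/-! ### The N-conditions in terms of arcs -/

section Arcs

variable {V : Type*} {R : SimpleGraph V} {n : ℕ} {F : Set (Set V)} {S : Set V} {r : ℤ → V} {d : ℕ}

/-- The restriction of `r` to `[0, d]` is a subpath of the cycle `R` with distinct endpoints,
whose inner vertices avoid `S`. -/
structure IsArc (R : SimpleGraph V) (n : ℕ) (S : Set V) (r : ℤ → V) (d : ℕ) : Prop where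
  param : CycParam R n r
  surj : Function.Surjective r
  pos : 0 < d
  lt : d < n
  inner : ∀ t : ℕ, 0 < t → t < d → r t ∉ S

theorem IsArc.mono {T : Set V} (h : IsArc R n S r d) (hT : T ⊆ S) : IsArc R n T r d :=
  ⟨h.param, h.surj, h.pos, h.lt, fun t h1 h2 h3 => h.inner t h1 h2 (hT h3)⟩

theorem IsArc.reverse (h : IsArc R n S r d) : IsArc R n S (fun t => r (d - t)) d :=
  ⟨h.param.flip d, CycParam.surjective_flip h.surj d, h.pos, h.lt, fun t h1 h2 => by
    have := h.inner (d - t) (by omega) (by omega)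
    rwa [Nat.cast_sub h2.le] at this⟩

/-- The N-conditions, on arcs of the rim instead of walks. The bound `4` of the first condition and
the whole of the fourth condition are redundant in a clique system. -/
structure ArcConditions (R : SimpleGraph V) (n : ℕ) (F : Set (Set V)) (ξ : V) : Prop where
  odd_arc : ∀ A ∈ F, ∀ r d, IsArc R n (⋃₀ F) r d → r 0 ∈ A → r d ∈ A → Odd d
  odd_card : ∀ A ∈ F, Odd A.ncard
  mem : ∀ A ∈ F, ξ ∈ A
  inter : ∀ A ∈ F, ∀ B ∈ F, A ≠ B → A ∩ B = {ξ}
  even_arc : ∀ A ∈ F, ∀ B ∈ F, A ≠ B → ∀ r d, IsArc R n (⋃₀ F) r d → r 0 ∈ A → r d ∈ B →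
    r 0 ≠ ξ → r d ≠ ξ → Even d

/-- The N-conditions for all subfamilies of `F` at once: the arcs of the first (last) condition need
only avoid the one clique (the two cliques) in question. -/
structure StrongArcConditions (R : SimpleGraph V) (n : ℕ) (F : Set (Set V)) (ξ : V) : Prop where
  odd_arc : ∀ A ∈ F, ∀ r d, IsArc R n A r d → r 0 ∈ A → r d ∈ A → Odd d
  odd_card : ∀ A ∈ F, Odd A.ncard
  mem : ∀ A ∈ F, ξ ∈ A
  inter : ∀ A ∈ F, ∀ B ∈ F, A ≠ B → A ∩ B = {ξ}
  even_arc : ∀ A ∈ F, ∀ B ∈ F, A ≠ B → ∀ r d, IsArc R n (A ∪ B) r d → r 0 ∈ A → r d ∈ B →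
    r 0 ≠ ξ → r d ≠ ξ → Even d

theorem StrongArcConditions.mono {ξ : V} {F' : Set (Set V)} (h : StrongArcConditions R n F ξ)
    (hF : F' ⊆ F) : StrongArcConditions R n F' ξ where
  odd_arc A hA := h.odd_arc A (hF hA)
  odd_card A hA := h.odd_card A (hF hA)
  mem A hA := h.mem A (hF hA)
  inter A hA B hB := h.inter A (hF hA) B (hF hB)
  even_arc A hA B hB := h.even_arc A (hF hA) B (hF hB)

theorem StrongArcConditions.arcConditions {ξ : V} (h : StrongArcConditions R n F ξ) :
    ArcConditions R n F ξ where
  odd_arc A hA r d hr := h.odd_arc A hA r d (hr.mono (Set.subset_sUnion_of_mem hA))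
  odd_card := h.odd_card
  mem := h.mem
  inter := h.inter
  even_arc A hA B hB hAB r d hr := h.even_arc A hA B hB hAB r d
    (hr.mono (Set.union_subset (Set.subset_sUnion_of_mem hA) (Set.subset_sUnion_of_mem hB)))

theorem strongArcConditions_of_forall (hne : F.Nonempty)
    (h : ∀ F' ⊆ F, F'.Nonempty → ∃ ξ, ArcConditions R n F' ξ) :
    ∃ ξ, StrongArcConditions R n F ξ := by
  obtain ⟨ξ, hξ⟩ := h F subset_rfl hne
  refine ⟨ξ, fun A hA r d hr => ?_, hξ.odd_card, hξ.mem, hξ.inter, fun A hA B hB hAB r d hr => ?_⟩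
  · obtain ⟨ζ, hζ⟩ := h {A} (Set.singleton_subset_iff.2 hA) (Set.singleton_nonempty A)
    exact hζ.odd_arc A rfl r d (by rwa [Set.sUnion_singleton])
  · have hsub : {A, B} ⊆ F := Set.insert_subset hA (Set.singleton_subset_iff.2 hB)
    obtain ⟨ζ, hζ⟩ := h {A, B} hsub (Set.insert_nonempty A {B})
    have hA' : A ∈ ({A, B} : Set (Set V)) := by simp
    have hB' : B ∈ ({A, B} : Set (Set V)) := by simp
    have e : ζ = ξ := Set.singleton_injective
      ((hζ.inter A hA' B hB' hAB).symm.trans (hξ.inter A hA B hB hAB))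
    rw [← e]
    exact hζ.even_arc A hA' B hB' hAB r d (by rwa [Set.sUnion_pair])

theorem IsArc.exists_walk (h : IsArc R n S r d) :
    ∃ p : R.Walk (r 0) (r d), p.IsPath ∧ p.length = d ∧
      ∀ w ∈ p.support, w ≠ r 0 → w ≠ r d → w ∉ S := by
  have key : ∀ e : ℕ, ∃ p : R.Walk (r 0) (r e), p.length = e ∧ ∀ t : ℕ, t ≤ e → p.getVert t = r t := by
    intro e
    induction e with
    | zero => exact ⟨SimpleGraph.Walk.nil, rfl, fun t ht => by simp [Nat.le_zero.1 ht]⟩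
    | succ e ih =>
      obtain ⟨p, hp, hg⟩ := ih
      have hadj := h.param.adj_succ e
      refine ⟨(p.concat hadj).copy rfl (by push_cast; rfl), by simp [hp], fun t ht => ?_⟩
      rw [SimpleGraph.Walk.getVert_copy, SimpleGraph.Walk.concat_eq_append,
        SimpleGraph.Walk.getVert_append]
      split_ifs with h1
      · exact hg t (by omega)
      · obtain rfl | rfl : t = e ∨ t = e + 1 := by omega
        · simp [hp]
        · simp [hp]
  obtain ⟨p, hp, hg⟩ := key d
  have hlt := h.lt
  refine ⟨p, ?_, hp, fun w hw h0 hd => ?_⟩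
  · rw [← SimpleGraph.Walk.IsPath.getVert_injOn_iff]
    intro s hs t ht hst
    simp only [Set.mem_ofPred_eq, hp] at hs ht
    rw [hg s hs, hg t ht] at hst
    exact_mod_cast h.param.eq_of_eq hst (by omega) (by omega)
  · obtain ⟨t, rfl, ht⟩ := SimpleGraph.Walk.mem_support_iff_exists_getVert.1 hw
    rw [hp] at ht
    rw [hg t ht] at h0 hd ⊢
    refine h.inner t (Nat.pos_of_ne_zero ?_) (lt_of_le_of_ne ht ?_)
    · rintro rfl
      exact h0 rfl
    · rintro rfl
      exact hd rfl

theorem exists_isArc_of_walk {f : ℤ → V} (hf : CycParam R n f) (hs : Function.Surjective f)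
    (hn : 0 < n) {u v : V} (p : R.Walk u v) (hp : p.IsPath) (huv : u ≠ v)
    (hin : ∀ w ∈ p.support, w ≠ u → w ≠ v → w ∉ S) :
    ∃ r, IsArc R n S r p.length ∧ r 0 = u ∧ r p.length = v := by
  have hinj := hp.getVert_injOn
  have hne : ∀ s t, s ≤ p.length → t ≤ p.length → s ≠ t → p.getVert s ≠ p.getVert t :=
    fun s t h1 h2 h3 h4 => h3 (hinj h1 h2 h4)
  have hpos : 0 < p.length := Nat.pos_of_ne_zero fun h0 =>
    huv (SimpleGraph.Walk.eq_of_length_eq_zero h0)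
  obtain ⟨r, hr, hrs, hg, -⟩ := hf.exists_eq_of_path hs (g := p.getVert) (d := p.length)
    (fun t ht => p.adj_getVert_succ ht) (fun t ht => hne _ _ (by omega) (by omega) (by omega))
  have h0 : r 0 = u := by simpa using hg 0 (by omega)
  have hd : r p.length = v := by simpa using hg p.length le_rfl
  refine ⟨r, ⟨hr, hrs, hpos, ?_, fun t ht1 ht2 => ?_⟩, h0, hd⟩
  · by_contra hlt
    apply hne 0 n (by omega) (by omega) (by omega)
    rw [← hg 0 (by omega), ← hg n (by omega)]
    simpa using (hr.add_period 0).symm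
  · rw [hg t ht2.le]
    refine hin _ (SimpleGraph.Walk.getVert_mem_support _ _) ?_ ?_
    · have := hne t 0 (by omega) (by omega) (by omega)
      simpa using this
    · have := hne t p.length (by omega) (by omega) (by omega)
      simpa using this

theorem nConditionsAt_iff {G : SimpleGraph V} (hS : CliqueSystem R F) (hR : rim G = R)
    (hF : ∀ A, IsInscribed G A ↔ A ∈ F) {f : ℤ → V} (hf : CycParam R n f)
    (hs : Function.Surjective f) (hn : 0 < n) (ξ : V) :
    NConditionsAt G ξ ↔ ArcConditions R n F ξ := by
  subst hR
  have arc : ∀ A B (u v : V) (p : (rim G).Walk u v), IsABPath G A B p →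
      ∃ r, IsArc (rim G) n (⋃₀ F) r p.length ∧ r 0 = u ∧ r p.length = v := fun A B u v p hp =>
    exists_isArc_of_walk hf hs hn p hp.1 hp.2.1 fun w hw h1 h2 ⟨X, hX, hwX⟩ =>
      hp.2.2.2.2 w hw h1 h2 X ((hF X).2 hX) hwX
  have walk : ∀ A B r d, IsArc (rim G) n (⋃₀ F) r d → r 0 ∈ A → r d ∈ B →
      ∃ p : (rim G).Walk (r 0) (r d), IsABPath G A B p ∧ p.support.length = d + 1 := by
    intro A B r d hr h0 hd
    obtain ⟨p, hp, hlen, hin⟩ := hr.exists_walk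
    have := hr.pos
    have := hr.lt
    exact ⟨p, ⟨hp, hr.param.ne (by omega) (by omega), h0, hd, fun w hw h1 h2 X hX hwX =>
      hin w hw h1 h2 ⟨X, (hF X).1 hX, hwX⟩⟩, by rw [SimpleGraph.Walk.length_support, hlen]⟩
  constructor
  · intro h
    refine ⟨fun A hA r d hr h0 hd => ?_, fun A hA => h.n2 A ((hF A).2 hA),
      fun A hA => h.n3_mem A ((hF A).2 hA),
      fun A hA B hB => h.n3_inter A B ((hF A).2 hA) ((hF B).2 hB),
      fun A hA B hB hAB r d hr h0 hd h0ξ hdξ => ?_⟩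
    · obtain ⟨p, hp, hlen⟩ := walk A A r d hr h0 hd
      have := (h.n1 A ((hF A).2 hA) _ _ p hp).1
      rw [hlen, Nat.even_iff] at this
      rw [Nat.odd_iff]
      omega
    · obtain ⟨p, hp, hlen⟩ := walk A B r d hr h0 hd
      have := h.n5 A B ((hF A).2 hA) ((hF B).2 hB) hAB _ _ p h0ξ hdξ hp
      rw [hlen, Nat.odd_iff] at this
      rw [Nat.even_iff]
      omega
  · intro h
    have hodd : ∀ A, IsInscribed G A → ∀ (u v : V) (p : (rim G).Walk u v), IsABPath G A A p →
        Even p.support.length ∧ 4 ≤ p.support.length := by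
      intro A hA u v p hp
      obtain ⟨r, hr, h0, hd⟩ := arc A A u v p hp
      have h1 := h.odd_arc A ((hF A).1 hA) r _ hr (by rw [h0]; exact hp.2.2.1)
        (by rw [hd]; exact hp.2.2.2.1)
      -- an arc of length one would join two vertices of `A` along the rim
      have h2 : p.length ≠ 1 := by
        intro e
        rw [e] at hd
        refine hS.indep A ((hF A).1 hA) u hp.2.2.1 v hp.2.2.2.1 ?_
        rw [← h0, ← hd]
        simpa using hr.param.adj_succ 0
      rw [SimpleGraph.Walk.length_support, Nat.even_iff]
      rw [Nat.odd_iff] at h1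
      omega
    refine ⟨hodd, fun A hA => h.odd_card A ((hF A).1 hA), fun A hA => h.mem A ((hF A).1 hA),
      fun A B hA hB => h.inter A ((hF A).1 hA) B ((hF B).1 hB), ?_, ?_⟩
    · intro A B hA hB _ u p hp
      exact (hodd A hA u ξ p ⟨hp.1, hp.2.1, hp.2.2.1, h.mem A ((hF A).1 hA), hp.2.2.2.2⟩).1
    · intro A B hA hB hAB u v p hu hv hp
      obtain ⟨r, hr, h0, hd⟩ := arc A B u v p hp
      have h1 := h.even_arc A ((hF A).1 hA) B ((hF B).1 hB) hAB r _ hr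
        (by rw [h0]; exact hp.2.2.1) (by rw [hd]; exact hp.2.2.2.1) (by rwa [h0]) (by rwa [hd])
      rw [SimpleGraph.Walk.length_support]
      exact h1.add_one

variable [Fintype V] {G : SimpleGraph V}

theorem IsMultisun.nConditions_withCliques_iff (hG : IsMultisun G)
    (hF : F ⊆ {A | IsInscribed G A}) (hne : F.Nonempty) :
    NConditions (withCliques (rim G) F) ↔ ∃ ξ, ArcConditions (rim G) (Fintype.card V) F ξ := by
  have hS := hG.cliqueSystem.mono hF
  obtain ⟨r, hr, hs⟩ := hG.exists_param
  have := hG.three_le_card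
  exact exists_congr fun ξ => nConditionsAt_iff hS hS.rim_eq
    (hS.isInscribed_iff hG.exists_rim_adj hne) hr hs (by omega) ξ

theorem IsMultisun.nConditions_iff (hG : IsMultisun G) :
    NConditions G ↔
      ∃ ξ, ArcConditions (rim G) (Fintype.card V) {A | IsInscribed G A} ξ := by
  rw [← hG.nConditions_withCliques_iff subset_rfl hG.exists_inscribed,
    ← IsMultisun.eq_withCliques G]

/-- A multisun is a sunoid if and only if its inscribed cliques satisfy the strong form of the
N-conditions. -/
theorem IsMultisun.isSunoid_iff (hG : IsMultisun G) :
    IsSunoid G ↔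
      ∃ ξ, StrongArcConditions (rim G) (Fintype.card V) {A | IsInscribed G A} ξ := by
  rw [IsSunoid, hG.hereditarily_iff]
  constructor
  · rintro ⟨-, h⟩
    exact strongArcConditions_of_forall hG.exists_inscribed fun F hF hne =>
      (hG.nConditions_withCliques_iff hF hne).1 (h F hF hne)
  · rintro ⟨ξ, h⟩
    exact ⟨hG, fun F hF hne => (hG.nConditions_withCliques_iff hF hne).2
      ⟨ξ, (h.mono hF).arcConditions⟩⟩

end Arcs

/-! ### Counting clique vertices along the rim -/

section Count

variable {V : Type*} {R : SimpleGraph V} {n : ℕ} {F : Set (Set V)} {A B : Set V} {r : ℤ → V}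
  {ξ : V}

open Classical in
/-- The number of the positions `0, …, p - 1` at which `r` meets `A`. -/
noncomputable def meets (r : ℤ → V) (A : Set V) (p : ℕ) : ℕ :=
  Nat.count (fun k : ℕ => r k ∈ A) p

theorem meets_zero : meets r A 0 = 0 := by
  classical
  exact Nat.count_zero _

theorem meets_succ_of_mem {p : ℕ} (h : r p ∈ A) : meets r A (p + 1) = meets r A p + 1 := by
  classical
  rw [meets, Nat.count_succ, if_pos h, meets]

theorem meets_succ_of_notMem {p : ℕ} (h : r p ∉ A) : meets r A (p + 1) = meets r A p := by
  classical
  rw [meets, Nat.count_succ, if_neg h, meets, add_zero]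

theorem meets_eq_of_forall {i j : ℕ} (hij : i ≤ j) (h : ∀ t : ℕ, i ≤ t → t < j → r t ∉ A) :
    meets r A j = meets r A i := by
  induction j, hij using Nat.le_induction with
  | base => rfl
  | succ j hj ih =>
    rw [meets_succ_of_notMem (h j hj (Nat.lt_succ_self j)), ih fun t h1 h2 => h t h1 (by omega)]

theorem meets_eq_succ {i j : ℕ} (hij : i < j) (hi : r i ∈ A)
    (h : ∀ t : ℕ, i < t → t < j → r t ∉ A) : meets r A j = meets r A i + 1 := by
  rw [← meets_succ_of_mem hi]
  exact meets_eq_of_forall hij fun t h1 h2 => h t h1 h2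

theorem meets_period (hr : CycParam R n r) (hs : Function.Surjective r) (hn : 0 < n) :
    meets r A n = A.ncard := by
  classical
  rw [meets, Nat.count_eq_card_filter_range, ← Set.ncard_coe_finset]
  refine Set.ncard_congr (fun k _ => r k) (fun k hk => ?_) (fun i j hi hj hij => ?_)
    fun v hv => ?_
  · simpa using (Finset.mem_filter.1 hk).2
  · have hi := Finset.mem_range.1 (Finset.mem_filter.1 hi).1
    have hj := Finset.mem_range.1 (Finset.mem_filter.1 hj).1
    exact_mod_cast hr.eq_of_eq hij (by omega) (by omega)
  · obtain ⟨p, hp, rfl⟩ := hr.exists_nat hn hs v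
    exact ⟨p, by simpa using ⟨hp, hv⟩, rfl⟩

theorem CycParam.isArc (hr : CycParam R n r) (hs : Function.Surjective r) {S : Set V} {i j : ℕ}
    (hij : i < j) (hlt : j < i + n) (h : ∀ t : ℕ, i < t → t < j → r t ∉ S) :
    IsArc R n S (fun t => r (i + t)) (j - i) := by
  refine ⟨hr.shift i, CycParam.surjective_shift hs i, by omega, by omega, fun t h1 h2 => ?_⟩
  have := h (i + t) (by omega) (by omega)
  push_cast at this
  exact this

/-- Along the rim, the parity of the position of a vertex of `A` is that of its rank in `A`. -/
theorem even_add_meets (hr : CycParam R n r) (hs : Function.Surjective r) (hn : 0 < n)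
    (hA : 3 ≤ A.ncard) (hodd : ∀ r d, IsArc R n A r d → r 0 ∈ A → r d ∈ A → Odd d)
    (h0 : r 0 ∈ A) {p : ℕ} (hp : p ≤ n) (hpA : r p ∈ A) : Even (p + meets r A p) := by
  have key := const_of_consecutive (P := fun t : ℕ => r t ∈ A)
    (g := fun t => (t + meets r A t) % 2) (N := n) ?_ 0 p (Nat.zero_le p) hp (by simpa using h0) hpA
  · rw [Nat.even_iff, ← key, meets_zero]
  · intro i j hij hj hi hjA hin
    have h1 := meets_eq_succ hij hi hin
    have hlt : j < i + n := by
      by_contra hge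
      obtain rfl : i = 0 := by omega
      obtain rfl : j = n := by omega
      rw [meets_period hr hs hn, meets_zero] at h1
      omega
    have h2 := hodd _ _ (hr.isArc hs hij hlt hin) (by simpa using hi) (by
      rw [Nat.cast_sub hij.le]
      simpa using hjA)
    rw [Nat.odd_iff] at h2
    omega

/-- An arc with no inner vertex equal to `ξ` can be placed inside one turn of the rim starting
and ending at `ξ`. -/
theorem IsArc.exists_placement {S : Set V} {d : ℕ} (h : IsArc R n S r d) (hξ : ξ ∈ S) :
    ∃ (r' : ℤ → V) (i : ℕ), CycParam R n r' ∧ Function.Surjective r' ∧ r' 0 = ξ ∧ i + d ≤ n ∧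
      ∀ t : ℤ, r' (i + t) = r t := by
  have hpos := h.pos
  have hlt := h.lt
  obtain ⟨s, hs, hds, hsn⟩ : ∃ s : ℕ, r s = ξ ∧ d ≤ s ∧ s ≤ n := by
    obtain ⟨s, hs, rfl⟩ := h.param.exists_nat (by omega) h.surj ξ
    rcases Nat.eq_zero_or_pos s with rfl | h0
    · exact ⟨n, by simpa using h.param.add_period 0, by omega, le_rfl⟩
    · exact ⟨s, rfl, by_contra fun hd => h.inner s h0 (by omega) hξ, hs.le⟩
  refine ⟨fun t => r (s + t), n - s, h.param.shift s, CycParam.surjective_shift h.surj s,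
    by simpa using hs, by omega, fun t => ?_⟩
  rw [← h.param.add_period t, Nat.cast_sub hsn]
  exact congrArg r (by ring)

/-- Any two cliques interlace in the following sense: for `a ∈ A` and `b ∈ B` other than `ξ`, the
number of the vertices of `B` that precede `a` and the number of the vertices of `A` that precede
`b` have different parities, when the rim is traversed from `ξ`. -/
def Interlaced (r : ℤ → V) (n : ℕ) (F : Set (Set V)) : Prop :=
  ∀ A ∈ F, ∀ B ∈ F, A ≠ B → ∀ p q : ℕ, 0 < p → p < n → 0 < q → q < n → r p ∈ A → r q ∈ B →
    Odd (meets r B p + meets r A q)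

theorem eq_zero_of_mem_mem (hr : CycParam R n r) (hinter : A ∩ B = {r 0}) {p : ℕ} (hp : p < n)
    (hA : r p ∈ A) (hB : r p ∈ B) : p = 0 := by
  have : r p ∈ A ∩ B := ⟨hA, hB⟩
  rw [hinter, Set.mem_singleton_iff] at this
  exact_mod_cast hr.eq_of_eq this (by omega) (by omega)

theorem StrongArcConditions.interlaced (h : StrongArcConditions R n F (r 0)) (hS : CliqueSystem R F)
    (hr : CycParam R n r) (hs : Function.Surjective r) (hn : 0 < n) : Interlaced r n F := by
  classical
  intro A hA B hB hAB p q hp0 hpn hq0 hqn hpA hqB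
  have evA : ∀ t : ℕ, t < n → r t ∈ A → Even (t + meets r A t) := fun t ht => even_add_meets hr hs
    hn (hS.three_le A hA) (h.odd_arc A hA) (h.mem A hA) ht.le
  have evB : ∀ t : ℕ, t < n → r t ∈ B → Even (t + meets r B t) := fun t ht => even_add_meets hr hs
    hn (hS.three_le B hB) (h.odd_arc B hB) (h.mem B hB) ht.le
  have disj : ∀ t : ℕ, 0 < t → t < n → r t ∈ A → r t ∈ B → False := fun t h0 h1 h2 h3 =>
    h0.ne' (eq_zero_of_mem_mem hr (h.inter A hA B hB hAB) h1 h2 h3)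
  have hξ : ∀ t : ℕ, 0 < t → t < n → r t ≠ r 0 := fun t h0 h1 =>
    (hr.ne (by omega) (by omega)).symm
  -- the parity below is the same at all vertices of `A ∪ B` other than `ξ`
  let g : ℕ → ℕ := fun t => if r t ∈ A then meets r B t % 2 else (meets r A t + 1) % 2
  have key := const_of_consecutive (P := fun t : ℕ => 0 < t ∧ r t ∈ A ∪ B) (g := g) (N := n - 1) ?_
  · have gp : g p = meets r B p % 2 := if_pos hpA
    have gq : g q = (meets r A q + 1) % 2 := if_neg fun hqA => disj q hq0 hqn hqA hqB
    have : g p = g q := by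
      rcases le_total p q with hpq | hpq
      · exact key p q hpq (by omega) ⟨hp0, Or.inl hpA⟩ ⟨hq0, Or.inr hqB⟩
      · exact (key q p hpq (by omega) ⟨hq0, Or.inr hqB⟩ ⟨hp0, Or.inl hpA⟩).symm
    rw [gp, gq] at this
    rw [Nat.odd_iff]
    omega
  · rintro i j hij hj ⟨hi0, hi⟩ ⟨hj0, hj'⟩ hin
    have hinA : ∀ t : ℕ, i < t → t < j → r t ∉ A := fun t h1 h2 h3 =>
      hin t h1 h2 ⟨by omega, Or.inl h3⟩
    have hinB : ∀ t : ℕ, i < t → t < j → r t ∉ B := fun t h1 h2 h3 =>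
      hin t h1 h2 ⟨by omega, Or.inr h3⟩
    have hinAB : ∀ t : ℕ, i < t → t < j → r t ∉ A ∪ B := fun t h1 h2 h3 =>
      hin t h1 h2 ⟨by omega, h3⟩
    have e : (i : ℤ) + ((j - i : ℕ) : ℤ) = j := by omega
    have same : ∀ C : Set V, r i ∉ C → (∀ t : ℕ, i < t → t < j → r t ∉ C) →
        meets r C j = meets r C i := fun C h1 h2 =>
      meets_eq_of_forall hij.le fun t h3 h4 => by
        rcases h3.eq_or_lt with rfl | h3
        · exact h1
        · exact h2 t h3 h4
    rcases hi with hiA | hiB <;> rcases hj' with hjA | hjB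
    · have hiB : r i ∉ B := disj i hi0 (by omega) hiA
      simp only [g, if_pos hiA, if_pos hjA, same B hiB hinB]
    · have hiB : r i ∉ B := disj i hi0 (by omega) hiA
      have hjA : r j ∉ A := fun hjA => disj j hj0 (by omega) hjA hjB
      have h1 := h.even_arc A hA B hB hAB _ _ (hr.isArc hs hij (by omega) hinAB)
        (by simpa using hiA) (by simpa only [e] using hjB) (by simpa using hξ i hi0 (by omega))
        (by simpa only [e] using hξ j hj0 (by omega))
      have h2 := evA i (by omega) hiA
      have h3 := evB j (by omega) hjB
      have h4 := same B hiB hinB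
      have h5 := meets_eq_succ hij hiA hinA
      rw [Nat.even_iff] at h1 h2 h3
      simp only [g, if_pos hiA, if_neg hjA]
      omega
    · have hiA : r i ∉ A := fun hiA => disj i hi0 (by omega) hiA hiB
      have h1 := h.even_arc B hB A hA hAB.symm _ _
        (hr.isArc hs hij (by omega) (by rwa [Set.union_comm]))
        (by simpa using hiB) (by simpa only [e] using hjA) (by simpa using hξ i hi0 (by omega))
        (by simpa only [e] using hξ j hj0 (by omega))
      have h2 := evB i (by omega) hiB
      have h3 := evA j (by omega) hjA
      have h4 := same A hiA hinA
      have h5 := meets_eq_succ hij hiB hinB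
      rw [Nat.even_iff] at h1 h2 h3
      simp only [g, if_neg hiA, if_pos hjA]
      omega
    · have hiA : r i ∉ A := fun hiA => disj i hi0 (by omega) hiA hiB
      have hjA : r j ∉ A := fun hjA => disj j hj0 (by omega) hjA hjB
      simp only [g, if_neg hiA, if_neg hjA, same A hiA hinA]

/-- The N-conditions pass to all subfamilies as soon as any two cliques interlace. -/
theorem ArcConditions.strong (h : ArcConditions R n F ξ) (hodd : Odd n)
    (hint : ∀ r, CycParam R n r → Function.Surjective r → r 0 = ξ → Interlaced r n F) :
    StrongArcConditions R n F ξ := by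
  have hn : 0 < n := hodd.pos
  -- the parity of the position of a vertex is that of its rank in its clique
  have key : ∀ r, CycParam R n r → Function.Surjective r → r 0 = ξ → ∀ p : ℕ, p < n →
      ∀ A ∈ F, r p ∈ A → Even (p + meets r A p) := by
    intro r hr hs h0 p
    induction p using Nat.strong_induction_on with
    | _ p ih =>
      intro hp A hA hpA
      rcases Nat.eq_zero_or_pos p with rfl | hp0
      · simp [meets_zero]
      obtain ⟨i, hip, hiF, hin⟩ : ∃ i : ℕ, i < p ∧ r i ∈ ⋃₀ F ∧
          ∀ t : ℕ, i < t → t < p → r t ∉ ⋃₀ F := by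
        classical
        have h1 := Nat.findGreatest_spec (P := fun t : ℕ => r t ∈ ⋃₀ F) (Nat.zero_le (p - 1))
          ⟨A, hA, by simpa [h0] using h.mem A hA⟩
        have h2 := Nat.findGreatest_le (P := fun t : ℕ => r t ∈ ⋃₀ F) (p - 1)
        refine ⟨_, by omega, h1, fun t h3 h4 => ?_⟩
        exact Nat.findGreatest_is_greatest h3 (by omega)
      have hinX : ∀ X ∈ F, ∀ t : ℕ, i < t → t < p → r t ∉ X := fun X hX t h1 h2 h3 =>
        hin t h1 h2 ⟨X, hX, h3⟩
      have e : (i : ℤ) + ((p - i : ℕ) : ℤ) = p := by omega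
      have harc := hr.isArc hs hip (by omega) hin
      by_cases hiA : r i ∈ A
      · have h1 := h.odd_arc A hA _ _ harc (by simpa using hiA) (by simpa only [e] using hpA)
        have h2 := ih i hip (by omega) A hA hiA
        have h3 := meets_eq_succ hip hiA (hinX A hA)
        rw [Nat.odd_iff] at h1
        rw [Nat.even_iff] at h2 ⊢
        omega
      · obtain ⟨B, hB, hiB⟩ := hiF
        have hAB : A ≠ B := fun e => hiA (e ▸ hiB)
        have hi0 : 0 < i := Nat.pos_of_ne_zero fun hi0 => by
          subst hi0
          exact hiA (by simpa [h0] using h.mem A hA)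
        have h1 := h.even_arc B hB A hA hAB.symm _ _ harc (by simpa using hiB)
          (by simpa only [e] using hpA)
          (by simpa [← h0] using (hr.ne (s := 0) (t := i) (by omega) (by omega)).symm)
          (by simpa only [e, ← h0] using (hr.ne (s := 0) (t := p) (by omega) (by omega)).symm)
        have h2 := ih i hip (by omega) B hB hiB
        have h3 := hint r hr hs h0 A hA B hB hAB p i hp0 hp hi0 (by omega) hpA hiB
        have h4 := meets_eq_succ hip hiB (hinX B hB)
        have h5 : meets r A p = meets r A i := meets_eq_of_forall hip.le fun t h6 h7 => by
          rcases h6.eq_or_lt with rfl | h6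
          · exact hiA
          · exact hinX A hA t h6 h7
        rw [Nat.even_iff] at h1 h2 ⊢
        rw [Nat.odd_iff] at h3
        omega
  refine ⟨fun A hA r d harc h0 hd => ?_, h.odd_card, h.mem, h.inter,
    fun A hA B hB hAB r d harc h0 hd h0ξ hdξ => ?_⟩
  · obtain ⟨r', i, hr, hs, hξ, hid, hrr⟩ := harc.exists_placement (h.mem A hA)
    have hpos := harc.pos
    have hlt := harc.lt
    have hi : r' i ∈ A := by have := hrr 0; rw [add_zero] at this; rwa [this]
    have h1 := key r' hr hs hξ i (by omega) A hA hi
    have h2 : meets r' A (i + d) = meets r' A i + 1 :=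
      meets_eq_succ (by omega) hi fun t h3 h4 => by
        have h5 := hrr (t - i : ℕ)
        rw [show (i : ℤ) + (t - i : ℕ) = t by omega] at h5
        rw [h5]
        exact harc.inner _ (by omega) (by omega)
    have h3 : Even (i + d + meets r' A (i + d)) := by
      rcases hid.lt_or_eq with h3 | h3
      · refine key r' hr hs hξ (i + d) h3 A hA ?_
        push_cast
        rwa [hrr]
      · rw [h3, meets_period hr hs hn]
        exact hodd.add_odd (h.odd_card A hA)
    rw [Nat.even_iff] at h1 h3
    rw [Nat.odd_iff]
    omega
  · obtain ⟨r', i, hr, hs, hξ, hid, hrr⟩ := harc.exists_placement (Or.inl (h.mem A hA))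
    have hpos := harc.pos
    have hlt := harc.lt
    have hi' : r' i = r 0 := by have := hrr 0; rwa [add_zero] at this
    have hi : r' i ∈ A := by rwa [hi']
    have hj : r' (i + d : ℕ) ∈ B := by push_cast; rwa [hrr]
    have hi0 : 0 < i := Nat.pos_of_ne_zero fun hi0 => h0ξ (by rw [← hi', hi0, ← hξ]; rfl)
    have hidn : i + d < n := lt_of_le_of_ne hid fun e => hdξ (by
      rw [← hrr, ← hξ, ← hr.add_period 0]
      congr 1
      omega)
    have hin : ∀ t : ℕ, i < t → t < i + d → r' t ∉ A ∪ B := fun t h3 h4 => by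
      have h5 := hrr (t - i : ℕ)
      rw [show (i : ℤ) + (t - i : ℕ) = t by omega] at h5
      rw [h5]
      exact harc.inner _ (by omega) (by omega)
    have hinter := h.inter A hA B hB hAB
    rw [← hξ] at hinter
    have hiB : r' i ∉ B := fun hiB => hi0.ne' (eq_zero_of_mem_mem hr hinter (by omega) hi hiB)
    have h1 := key r' hr hs hξ i (by omega) A hA hi
    have h2 := key r' hr hs hξ (i + d) hidn B hB hj
    have h3 := hint r' hr hs hξ A hA B hB hAB i (i + d) hi0 (by omega) (by omega) hidn hi hj
    have h4 : meets r' A (i + d) = meets r' A i + 1 :=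
      meets_eq_succ (by omega) hi fun t h3 h4 h5 => hin t h3 h4 (Or.inl h5)
    have h5 : meets r' B (i + d) = meets r' B i := meets_eq_of_forall (by omega) fun t h6 h7 => by
      rcases h6.eq_or_lt with rfl | h6
      · exact hiB
      · exact fun h8 => hin t h6 h7 (Or.inr h8)
    rw [Nat.even_iff] at h1 h2 ⊢
    rw [Nat.odd_iff] at h3
    omega

end Count

/-! ### The strong N-conditions exclude odd holes -/

section NoOddHole

variable {V : Type*} {R : SimpleGraph V} {n m : ℕ} {F : Set (Set V)} {A B C : Set V}
  {r f : ℤ → V} {ξ : V}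

/-- A hole has no three vertices in the same clique. -/
theorem CycParam.not_mem_three (hf : CycParam (withCliques R F) m f) (hm : 4 ≤ m) (hA : A ∈ F)
    {s t u : ℤ} (hst : s < t) (htu : t < u) (hu : u < s + m) (h1 : f s ∈ A) (h2 : f t ∈ A)
    (h3 : f u ∈ A) : False := by
  have a1 := (hf.adj_iff_of_lt hst (by omega)).1
    (Or.inr ⟨hf.ne hst (by omega), A, hA, h1, h2⟩)
  have a2 := (hf.adj_iff_of_lt htu (by omega)).1
    (Or.inr ⟨hf.ne htu (by omega), A, hA, h2, h3⟩)
  have a3 := (hf.adj_iff_of_lt (hst.trans htu) (by omega)).1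
    (Or.inr ⟨hf.ne (hst.trans htu) (by omega), A, hA, h1, h3⟩)
  omega

/-- A stretch of a hole that follows the rim is an arc. -/
theorem CycParam.exists_arc_of_segment (hf : CycParam (withCliques R F) m f) (hr : CycParam R n r)
    (hs : Function.Surjective r) (hn : 0 < n) {i j : ℕ} (hij : i < j) (hj : j < m) {S : Set V}
    (hrim : ∀ t : ℕ, i ≤ t → t < j → R.Adj (f t) (f (t + 1)))
    (hin : ∀ t : ℕ, i < t → t < j → f t ∉ S) :
    ∃ r', IsArc R n S r' (j - i) ∧ r' 0 = f i ∧ r' (j - i : ℕ) = f j := by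
  obtain ⟨r', hr', hs', hg, -⟩ := hr.exists_eq_of_path hs (g := fun k : ℕ => f (i + k))
    (d := j - i) (fun t ht => by
      have := hrim (i + t) (by omega) (by omega)
      push_cast at this ⊢
      rwa [← add_assoc]) (fun t ht => hf.ne (by push_cast; omega) (by push_cast; omega))
  have h0 := hg 0 (by omega)
  refine ⟨r', ⟨hr', hs', by omega, ?_, fun t h1 h2 => ?_⟩, by simpa using h0, ?_⟩
  · by_contra hlt
    have h1 := hg n (by omega)
    have h2 := hr'.add_period 0
    rw [zero_add] at h2
    refine hf.ne (s := i) (t := i + n) (by omega) (by omega) ?_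
    rw [← h1, h2]
    simpa using h0.symm
  · rw [hg t h2.le]
    have := hin (i + t) (by omega) (by omega)
    push_cast at this
    exact this
  · rw [hg _ le_rfl]
    congr 1
    omega

/-- Off a clique `C` that contains an edge of the hole, and if the hole avoids `ξ`, the number of
the vertices of `C` that precede a vertex of the hole has constant parity: no other vertex of `C`
lies on the hole, and the interlacing controls the edges inside the other cliques. -/
theorem CycParam.meets_const (hf : CycParam (withCliques R F) m f) (hm : 4 ≤ m)
    (hr : CycParam R n r) (hs : Function.Surjective r) (hn : 0 < n) (hint : Interlaced r n F)
    (hξ : ∀ t, f t ≠ r 0) (hC : C ∈ F) {e : ℤ} (he : f e ∈ C) (he1 : f (e + 1) ∈ C)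
    {x y : ℤ} (hx : f x ∉ C) (hy : f y ∉ C) {p q : ℕ} (hp : p < n) (hq : q < n)
    (hpx : r p = f x) (hqy : r q = f y) : meets r C p % 2 = meets r C q % 2 := by
  have pos : ∀ (t : ℤ) (p : ℕ), r p = f t → 0 < p := fun t p h => Nat.pos_of_ne_zero fun h0 =>
    hξ t (by rw [← h, h0]; rfl)
  have off : ∀ k : ℕ, 2 ≤ k → k < m → f (e + k) ∉ C := fun k h1 h2 h3 =>
    hf.not_mem_three hm hC (s := e) (t := e + 1) (u := e + k) (by omega) (by omega) (by omega)
      he he1 h3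
  have step : ∀ (t : ℤ) (p q : ℕ), p < n → q < n → r p = f t → r q = f (t + 1) → f t ∉ C →
      f (t + 1) ∉ C → meets r C p % 2 = meets r C q % 2 := by
    intro t p q hp hq hpt hqt hx hy
    have h0p := pos _ _ hpt
    have h0q := pos _ _ hqt
    rcases hf.adj_succ t with hadj | ⟨hne, X, hX, h1, h2⟩
    · rw [← hpt] at hx
      rw [← hqt] at hy
      rw [← hpt, ← hqt] at hadj
      rcases lt_trichotomy p q with h | h | h
      · have := (hr.adj_iff_of_lt (by omega) (by omega)).1 hadj
        obtain rfl : q = p + 1 := by omega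
        rw [meets_succ_of_notMem hx]
      · rw [h]
      · have := (hr.adj_iff_of_lt (by omega) (by omega)).1 hadj.symm
        obtain rfl : p = q + 1 := by omega
        rw [meets_succ_of_notMem hy]
    · obtain ⟨c, hcn, hc⟩ := hr.exists_nat hn hs (f e)
      have hXC : X ≠ C := fun h => hx (h ▸ h1)
      have i1 := hint X hX C hC hXC p c h0p hp (pos _ _ hc) hcn (by rwa [hpt]) (by rwa [hc])
      have i2 := hint X hX C hC hXC q c h0q hq (pos _ _ hc) hcn (by rwa [hqt]) (by rwa [hc])
      rw [Nat.odd_iff] at i1 i2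
      omega
  have run : ∀ k : ℕ, 2 ≤ k → k < m → ∀ a b : ℕ, a < n → b < n → r a = f (e + 2) →
      r b = f (e + k) → meets r C a % 2 = meets r C b % 2 := by
    intro k hk
    induction k, hk using Nat.le_induction with
    | base =>
      intro _ a b ha hb hat hbt
      rw [show a = b by exact_mod_cast hr.eq_of_eq (hat.trans hbt.symm) (by omega) (by omega)]
    | succ k hk ih =>
      intro hkm a b ha hb hat hbt
      obtain ⟨c, hcn, hc⟩ := hr.exists_nat hn hs (f (e + k))
      have h1 := off (k + 1) (by omega) hkm
      push_cast at h1 hbt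
      rw [← add_assoc] at h1 hbt
      exact (ih (by omega) a c ha hcn hat hc).trans
        (step (e + k) c b hcn hb hc hbt (off k hk (by omega)) h1)
  have off' : ∀ x, f x ∉ C → ∃ k : ℕ, 2 ≤ k ∧ k < m ∧ f (e + k) = f x := by
    intro x hx
    obtain ⟨k, hk, hkx⟩ := hf.exists_lt (by omega) e x
    refine ⟨k, ?_, hk, hkx⟩
    by_contra hlt
    obtain rfl | rfl : k = 0 ∨ k = 1 := by omega
    · exact hx (by rw [← hkx]; simpa using he)
    · exact hx (by rw [← hkx]; simpa using he1)
  obtain ⟨a, han, ha⟩ := hr.exists_nat hn hs (f (e + 2))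
  obtain ⟨k, hk2, hkm, hk⟩ := off' x hx
  obtain ⟨l, hl2, hlm, hl⟩ := off' y hy
  exact (run k hk2 hkm a p han hp ha (hpx.trans hk.symm)).symm.trans
    (run l hl2 hlm a q han hq ha (hqy.trans hl.symm))

/-- A hole that avoids `ξ` has edges inside at most two of the cliques: three cliques would have to
be pairwise interlaced in a cyclic fashion. -/
theorem CycParam.not_three_chords (hf : CycParam (withCliques R F) m f) (hm : 4 ≤ m)
    (hr : CycParam R n r) (hs : Function.Surjective r) (hn : 0 < n) (hint : Interlaced r n F)
    (hinter : ∀ A ∈ F, ∀ B ∈ F, A ≠ B → A ∩ B = {r 0})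
    (hξ : ∀ t, f t ≠ r 0) (hA : A ∈ F) (hB : B ∈ F) (hC : C ∈ F) (hAB : A ≠ B) (hAC : A ≠ C)
    (hBC : B ≠ C) {a b c : ℤ} (ha : f a ∈ A) (ha' : f (a + 1) ∈ A) (hb : f b ∈ B)
    (hb' : f (b + 1) ∈ B) (hc : f c ∈ C) (hc' : f (c + 1) ∈ C) : False := by
  have pos : ∀ t : ℤ, ∃ p : ℕ, 0 < p ∧ p < n ∧ r p = f t := fun t => by
    obtain ⟨p, hp, h⟩ := hr.exists_nat hn hs (f t)
    exact ⟨p, Nat.pos_of_ne_zero fun h0 => hξ t (by rw [← h, h0]; rfl), hp, h⟩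
  have out : ∀ X ∈ F, ∀ Y ∈ F, X ≠ Y → ∀ t, f t ∈ X → f t ∉ Y := fun X hX Y hY hXY t h1 h2 => by
    have : f t ∈ X ∩ Y := ⟨h1, h2⟩
    rw [hinter X hX Y hY hXY] at this
    exact hξ t this
  obtain ⟨p, hp0, hpn, hp⟩ := pos a
  obtain ⟨q, hq0, hqn, hq⟩ := pos b
  obtain ⟨s, hs0, hsn, hs'⟩ := pos c
  have i1 := hint A hA B hB hAB p q hp0 hpn hq0 hqn (hp ▸ ha) (hq ▸ hb)
  have i2 := hint A hA C hC hAC p s hp0 hpn hs0 hsn (hp ▸ ha) (hs' ▸ hc)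
  have i3 := hint B hB C hC hBC q s hq0 hqn hs0 hsn (hq ▸ hb) (hs' ▸ hc)
  have c1 := hf.meets_const hm hr hs hn hint hξ hA ha ha' (out B hB A hA hAB.symm b hb)
    (out C hC A hA hAC.symm c hc) hqn hsn hq hs'
  have c2 := hf.meets_const hm hr hs hn hint hξ hB hb hb' (out A hA B hB hAB a ha)
    (out C hC B hB hBC.symm c hc) hpn hsn hp hs'
  have c3 := hf.meets_const hm hr hs hn hint hξ hC hc hc' (out A hA C hC hAC a ha)
    (out B hB C hC hBC b hb) hpn hqn hp hq
  rw [Nat.odd_iff] at i1 i2 i3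
  omega

/-- A hole cannot consist of rim edges only: it would be the whole rim. -/
theorem CycParam.exists_chord (hf : CycParam (withCliques R F) m f) (hm : 4 ≤ m)
    (hr : CycParam R n r) (hs : Function.Surjective r) (hn : 0 < n) (hS : CliqueSystem R F)
    (hne : F.Nonempty) : ∃ A ∈ F, ∃ e, f e ∈ A ∧ f (e + 1) ∈ A := by
  by_contra! hno
  have hrim : ∀ t, R.Adj (f t) (f (t + 1)) := fun t =>
    (hf.adj_succ t).resolve_right fun ⟨_, A, hA, h1, h2⟩ => hno A hA t h1 h2
  obtain ⟨r', hr', hs', hg, -⟩ := hr.exists_eq_of_path hs (g := fun k : ℕ => f k) (d := n)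
    (fun t _ => by simpa using hrim t) (fun t _ => hf.ne (by push_cast; omega) (by push_cast; omega))
  obtain ⟨A, hA⟩ := hne
  have hmeet : ∀ v, ∃ t : ℕ, t < m ∧ f t = v := fun v => by
    obtain ⟨p, hp, rfl⟩ := hr'.exists_nat hn hs' v
    rw [hg p hp.le]
    obtain ⟨k, hk, h⟩ := hf.exists_lt (by omega) 0 p
    exact ⟨k, hk, by simpa using h⟩
  have h3 := hS.three_le A hA
  obtain ⟨u, v, w, hu, hv, hw, huv, huw, hvw⟩ :=
    (Set.two_lt_ncard_iff (Set.finite_of_ncard_ne_zero (by omega))).1 h3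
  obtain ⟨a, ha, rfl⟩ := hmeet u
  obtain ⟨b, hb, rfl⟩ := hmeet v
  obtain ⟨c, hc, rfl⟩ := hmeet w
  have H : ∀ s t u : ℕ, s < t → t < u → u < m → f s ∈ A → f t ∈ A → f u ∈ A → False :=
    fun s t u h1 h2 h3 => hf.not_mem_three hm hA (by omega) (by omega) (by omega)
  have h1 : a ≠ b := fun e => huv (by rw [e])
  have h2 : a ≠ c := fun e => huw (by rw [e])
  have h3 : b ≠ c := fun e => hvw (by rw [e])
  rcases h1.lt_or_gt with h1 | h1 <;> rcases h2.lt_or_gt with h2 | h2 <;>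
    rcases h3.lt_or_gt with h3 | h3
  · exact H a b c h1 h3 hc hu hv hw
  · exact H a c b h2 h3 hb hu hw hv
  · omega
  · exact H c a b h2 h1 hb hw hu hv
  · exact H b a c h1 h2 hc hv hu hw
  · omega
  · exact H b c a h3 h2 ha hv hw hu
  · exact H c b a h3 h1 ha hw hv hu

theorem StrongArcConditions.not_odd_hole (h : StrongArcConditions R n F ξ) (hS : CliqueSystem R F)
    (hne : F.Nonempty) (hr : CycParam R n r) (hs : Function.Surjective r) (hn : 0 < n)
    (hm : 4 ≤ m) (hodd : Odd m) (hf : CycParam (withCliques R F) m f) : False := by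
  -- the hole is traversed so that its last edge lies in the clique `A`
  obtain ⟨A, hA, e, he, he1⟩ := hf.exists_chord hm hr hs hn hS hne
  obtain ⟨f, hf, hlast, hA0⟩ : ∃ g, CycParam (withCliques R F) m g ∧ g (-1) ∈ A ∧ g 0 ∈ A :=
    ⟨_, hf.shift (e + 1), by simpa using he, by simpa using he1⟩
  have hend : f (m - 1 : ℕ) ∈ A := by
    rw [← hf.add_period (-1)] at hlast
    rwa [show ((m - 1 : ℕ) : ℤ) = -1 + m by omega]
  have inA : ∀ t : ℕ, 0 < t → t < m - 1 → f t ∉ A := fun t h1 h2 h3 =>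
    hf.not_mem_three hm hA (s := -1) (t := 0) (u := t) (by omega) (by omega) (by omega) hlast hA0 h3
  have offA : ∀ t : ℕ, t + 1 < m → f t ∈ A → f (t + 1) ∈ A → False := fun t h1 h2 h3 => by
    rcases Nat.eq_zero_or_pos t with rfl | h0
    · exact inA 1 (by omega) (by omega) (by simpa using h3)
    · exact inA t h0 (by omega) h2
  have chord : ∀ t : ℕ, t + 1 < m → ¬ R.Adj (f t) (f (t + 1)) →
      ∃ X ∈ F, A ≠ X ∧ f t ∈ X ∧ f (t + 1) ∈ X := fun t h1 h2 => by
    obtain ⟨-, X, hX, h3, h4⟩ := (hf.adj_succ t).resolve_left h2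
    exact ⟨X, hX, fun e => offA t h1 (e ▸ h3) (e ▸ h4), h3, h4⟩
  rw [Nat.odd_iff] at hodd
  by_cases hB : ∃ s : ℕ, s + 1 < m ∧ ∃ B ∈ F, A ≠ B ∧ f s ∈ B ∧ f (s + 1) ∈ B
  swap
  · -- a single clique: the hole is an arc closed by one edge of `A`
    have hrim : ∀ t : ℕ, 0 ≤ t → t < m - 1 → R.Adj (f t) (f (t + 1)) := fun t _ h2 => by
      by_contra hcon
      exact hB ⟨t, by omega, chord t (by omega) hcon⟩
    obtain ⟨r', harc, h0, h1⟩ := hf.exists_arc_of_segment hr hs hn (i := 0) (j := m - 1)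
      (by omega) (by omega) hrim inA
    have := h.odd_arc A hA r' _ harc (by rw [h0]; simpa using hA0) (by rw [h1]; exact hend)
    rw [Nat.odd_iff] at this
    omega
  obtain ⟨s, hsm, B, hB, hAB, hs0, hs1⟩ := hB
  have inB : ∀ t : ℕ, t < m → t ≠ s → t ≠ s + 1 → f t ∉ B := fun t h1 h2 h3 h4 => by
    rcases lt_or_ge t s with h5 | h5
    · exact hf.not_mem_three hm hB (s := t) (t := s) (u := s + 1) (by omega) (by omega) (by omega)
        h4 hs0 hs1
    · exact hf.not_mem_three hm hB (s := s) (t := s + 1) (u := t) (by omega) (by omega) (by omega)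
        hs0 hs1 h4
  have hs1' : f (s + 1 : ℕ) ∈ B := by exact_mod_cast hs1
  have isξ : ∀ t, f t ∈ A → f t ∈ B → f t = ξ := fun t h1 h2 => by
    have : f t ∈ A ∩ B := ⟨h1, h2⟩
    rwa [h.inter A hA B hB hAB] at this
  by_cases hC : ∃ t : ℕ, t + 1 < m ∧ ∃ C ∈ F, A ≠ C ∧ B ≠ C ∧ f t ∈ C ∧ f (t + 1) ∈ C
  · obtain ⟨t, htm, C, hC, hAC, hBC, ht0, ht1⟩ := hC
    have inC : ∀ u : ℕ, u < m → u ≠ t → u ≠ t + 1 → f u ∉ C := fun u h1 h2 h3 h4 => by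
      rcases lt_or_ge u t with h5 | h5
      · exact hf.not_mem_three hm hC (s := u) (t := t) (u := t + 1) (by omega) (by omega)
          (by omega) h4 ht0 ht1
      · exact hf.not_mem_three hm hC (s := t) (t := t + 1) (u := u) (by omega) (by omega)
          (by omega) ht0 ht1 h4
    have hst : s ≠ t := fun e => by
      subst e
      exact hBC (hS.linear B hB C hC _ _ (hf.ne (by omega) (by omega)) hs0 ht0 hs1 ht1)
    -- `ξ` has only two neighbours on the hole, too few for three cliques
    have hξ : ∀ x, f x ≠ ξ := fun x hx => by
      obtain ⟨u, hu, hux⟩ := hf.exists_lt (by omega) 0 x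
      rw [zero_add] at hux
      have memF : ∀ X ∈ F, f u ∈ X := fun X hX => by
        rw [hux, hx]
        exact h.mem X hX
      have h1 : ¬ (0 < u ∧ u < m - 1) := fun h1 => inA u h1.1 h1.2 (memF A hA)
      have h2 : ¬ (u ≠ s ∧ u ≠ s + 1) := fun h2 => inB u hu h2.1 h2.2 (memF B hB)
      have h3 : ¬ (u ≠ t ∧ u ≠ t + 1) := fun h3 => inC u hu h3.1 h3.2 (memF C hC)
      omega
    obtain ⟨c, hc⟩ := hs ξ
    obtain ⟨r, hr, hs, hr0⟩ : ∃ r', CycParam R n r' ∧ Function.Surjective r' ∧ r' 0 = ξ :=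
      ⟨_, hr.shift c, CycParam.surjective_shift hs c, by simpa using hc⟩
    subst hr0
    exact hf.not_three_chords hm hr hs hn (h.interlaced hS hr hs hn) h.inter hξ hA hB hC hAB hAC
      hBC (a := -1) hlast (by simpa using hA0) hs0 hs1 ht0 ht1
  · have hrim : ∀ t : ℕ, t + 1 < m → t ≠ s → R.Adj (f t) (f (t + 1)) := fun t h1 h2 => by
      by_contra hcon
      obtain ⟨X, hX, hAX, h3, h4⟩ := chord t h1 hcon
      by_cases hBX : B = X
      · subst hBX
        have h5 := mt (inB t (by omega) h2) (not_not.2 h3)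
        have h6 := mt (inB (t + 1) (by omega) (by omega)) (by push_cast; exact not_not.2 h4)
        omega
      · exact hC ⟨t, h1, X, hX, hAX, hBX, h3, h4⟩
    -- the two stretches between the edges in `A` and `B` have even lengths
    have left : 0 < s → f 0 ≠ ξ → f s ≠ ξ → Even s := fun h0 h1 h2 => by
      obtain ⟨r', harc, h3, h4⟩ := hf.exists_arc_of_segment hr hs hn (S := A ∪ B) h0 (by omega)
        (fun t _ h4 => hrim t (by omega) (by omega)) (fun t h3 h4 => by
          rintro (h5 | h5)
          · exact inA t h3 (by omega) h5
          · exact inB t (by omega) (by omega) (by omega) h5)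
      simpa using h.even_arc A hA B hB hAB r' _ harc (by rw [h3]; simpa using hA0)
        (by rw [h4]; exact hs0) (by rw [h3]; simpa using h1) (by rw [h4]; exact h2)
    have right : s + 1 < m - 1 → f (s + 1 : ℕ) ≠ ξ → f (m - 1 : ℕ) ≠ ξ →
        Even (m - 1 - (s + 1)) := fun h0 h1 h2 => by
      obtain ⟨r', harc, h3, h4⟩ := hf.exists_arc_of_segment hr hs hn (S := A ∪ B) h0 (by omega)
        (fun t h3 h4 => hrim t (by omega) (by omega)) (fun t h3 h4 => by
          rintro (h5 | h5)
          · exact inA t (by omega) (by omega) h5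
          · exact inB t (by omega) (by omega) (by omega) h5)
      refine h.even_arc B hB A hA hAB.symm r' _ (by rwa [Set.union_comm]) ?_ ?_ ?_ ?_
      · rwa [h3]
      · rwa [h4]
      · rwa [h3]
      · rwa [h4]
    have ne : ∀ a b : ℕ, a < m → b < m → a ≠ b → f a = ξ → f b ≠ ξ := fun a b h1 h2 h3 h4 h5 => by
      have := hf.eq_of_eq (h4.trans h5.symm) (by omega) (by omega)
      omega
    simp only [Nat.even_iff] at left right
    rcases Nat.eq_zero_or_pos s with rfl | hs0'
    · have h0 : f (0 : ℕ) = ξ := isξ _ (by simpa using hA0) hs0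
      have := right (by omega) (ne _ _ (by omega) (by omega) (by omega) h0)
        (ne _ _ (by omega) (by omega) (by omega) h0)
      omega
    rcases (show s + 1 ≤ m - 1 by omega).eq_or_lt with h1 | h1
    · have h0 : f (s + 1 : ℕ) = ξ := isξ _ (by rw [h1]; exact hend) hs1'
      have := left hs0' (by simpa using ne _ 0 (by omega) (by omega) (by omega) h0)
        (ne _ _ (by omega) (by omega) (by omega) h0)
      omega
    · have hB' : ξ ∈ B := h.mem B hB
      have hA' : ξ ∈ A := h.mem A hA
      have h2 := left hs0'
        (fun e => inB 0 (by omega) (by omega) (by omega) (by simpa [e] using hB'))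
        (fun e => inA s hs0' (by omega) (by simpa [e] using hA'))
      have h3 := right h1 (fun e => inA (s + 1) (by omega) (by omega) (by rwa [e]))
        (fun e => inB (m - 1) (by omega) (by omega) (by omega) (by rwa [e]))
      omega

end NoOddHole

/-! ### Excluding odd holes hereditarily forces the strong N-conditions -/

section Necessity

variable {V : Type*} {R : SimpleGraph V} {n d d' : ℕ} {F : Set (Set V)} {A B : Set V}
  {r r' : ℤ → V} {ξ : V}

theorem withCliques_singleton_adj {u v : V} :
    (withCliques R {A}).Adj u v ↔ R.Adj u v ∨ (u ≠ v ∧ u ∈ A ∧ v ∈ A) := by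
  simp [withCliques_adj]

theorem withCliques_pair_adj {u v : V} :
    (withCliques R {A, B}).Adj u v ↔
      R.Adj u v ∨ (u ≠ v ∧ (u ∈ A ∧ v ∈ A ∨ u ∈ B ∧ v ∈ B)) := by
  simp [withCliques_adj]

/-- A rim edge lies in no triangle. -/
theorem CliqueSystem.not_triangle (hS : CliqueSystem R F) {u v w : V} (huv : R.Adj u v)
    (hvw : (withCliques R F).Adj v w) (huw : (withCliques R F).Adj u w) : False := by
  obtain ⟨A, hA, hu, hv, -⟩ := hS.triangle u v w (Or.inl huv) hvw huw
  exact hS.indep A hA u hu v hv huv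

/-- An arc between two vertices of `A` closes up through `A` to a hole. -/
theorem IsArc.odd_of_oddHoleFree (h : IsArc R n A r d) (hS : CliqueSystem R F) (hA : A ∈ F)
    (h0 : r 0 ∈ A) (hd : r d ∈ A) (hfree : OddHoleFree (withCliques R {A})) : Odd d := by
  by_contra hev
  rw [Nat.not_odd_iff_even] at hev
  have hr := h.param
  have hpos := h.pos
  have hlt := h.lt
  have mem : ∀ t : ℕ, t ≤ d → (r t ∈ A ↔ t = 0 ∨ t = d) := fun t ht => by
    constructor
    · intro h1
      by_contra! h2
      exact h.inner t (Nat.pos_of_ne_zero h2.1) (lt_of_le_of_ne ht h2.2) h1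
    · rintro (rfl | rfl)
      · simpa using h0
      · exact hd
  have hd3 : 3 ≤ d := by
    by_contra hd3
    obtain rfl : d = 2 := by
      rw [Nat.even_iff] at hev
      omega
    have h1 := hr.adj_succ 0
    have h2 := hr.adj_succ 1
    exact hS.not_triangle h1 (Or.inl h2)
      (Or.inr ⟨hr.ne (by norm_num) (by norm_num; omega), A, hA, h0, hd⟩)
  refine hfree (d + 1) (by omega) hev.add_one (cycleGraph_isIndContained_of (g := fun t => r t)
    (fun s t h1 h2 => hr.ne (by omega) (by omega)) fun s t h1 h2 => ?_)
  rw [withCliques_singleton_adj, hr.adj_iff_of_lt (by omega) (by omega), mem s (by omega),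
    mem t (by omega)]
  have := hr.ne (s := s) (t := t) (by omega) (by omega)
  simp only [ne_eq, this, not_false_eq_true, true_and]
  omega

/-- An arc from `A` to `B` that avoids the common vertex `ξ` closes up through `ξ` to a hole. -/
theorem IsArc.even_of_oddHoleFree (h : IsArc R n (A ∪ B) r d) (hS : CliqueSystem R F) (hA : A ∈ F)
    (hB : B ∈ F) (hinter : A ∩ B = {ξ}) (h0 : r 0 ∈ A) (hd : r d ∈ B) (h0ξ : r 0 ≠ ξ)
    (hdξ : r d ≠ ξ) (hfree : OddHoleFree (withCliques R {A, B})) : Even d := by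
  by_contra hev
  rw [Nat.not_even_iff_odd] at hev
  have hr := h.param
  have hpos := h.pos
  have hlt := h.lt
  have hξ : ξ ∈ A ∩ B := by rw [hinter]; rfl
  have only : ∀ v, v ∈ A → v ∈ B → v = ξ := fun v h1 h2 => by
    have : v ∈ A ∩ B := ⟨h1, h2⟩
    rwa [hinter] at this
  have memA : ∀ t : ℕ, t ≤ d → (r t ∈ A ↔ t = 0) := fun t ht => by
    constructor
    · intro h1
      by_contra h2
      rcases ht.lt_or_eq with h3 | rfl
      · exact h.inner t (Nat.pos_of_ne_zero h2) h3 (Or.inl h1)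
      · exact hdξ (only _ h1 hd)
    · rintro rfl
      simpa using h0
  have memB : ∀ t : ℕ, t ≤ d → (r t ∈ B ↔ t = d) := fun t ht => by
    constructor
    · intro h1
      by_contra h2
      rcases Nat.eq_zero_or_pos t with rfl | h3
      · exact h0ξ (only _ h0 (by simpa using h1))
      · exact h.inner t h3 (lt_of_le_of_ne ht h2) (Or.inr h1)
    · rintro rfl
      exact hd
  have hne : ∀ t : ℕ, t ≤ d → r t ≠ ξ := fun t ht e => by
    have h1 := (memA t ht).1 (e ▸ hξ.1)
    have h2 := (memB t ht).1 (e ▸ hξ.2)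
    omega
  have adjξ : ∀ t : ℕ, 0 < t → t < d → ¬ R.Adj (r t) ξ := fun t h1 h2 h3 => by
    rcases hr.eq_or_eq_of_adj h.surj h3 with h4 | h4
    · exact hne (t + 1) (by omega) (by push_cast; exact h4.symm)
    · exact hne (t - 1) (by omega) (by rw [h4]; congr 1; omega)
  have a0 : (withCliques R F).Adj (r 0) ξ := Or.inr ⟨h0ξ, A, hA, h0, hξ.1⟩
  have ad : (withCliques R F).Adj (r d) ξ := Or.inr ⟨hdξ, B, hB, hd, hξ.2⟩
  have hnr : ¬ R.Adj (r 0) (r d) := fun h1 => hS.not_triangle h1 ad a0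
  have hd3 : 3 ≤ d := by
    by_contra hd3
    obtain rfl : d = 1 := by
      rw [Nat.odd_iff] at hev
      omega
    exact hnr (by simpa using hr.adj_succ 0)
  have hdn : d + 1 ≠ n := fun e => hnr ((hr.adj_iff_of_lt (by omega) (by omega)).2
    (Or.inr (by push_cast [← e]; ring)))
  refine hfree (d + 2) (by omega) (by simpa [Nat.odd_add] using hev) (cycleGraph_isIndContained_of
    (g := fun t => if t ≤ d then r t else ξ) (fun s t h1 h2 => ?_) fun s t h1 h2 => ?_)
  · rw [if_pos (show s ≤ d by omega)]
    split_ifs with h3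
    · exact hr.ne (by omega) (by omega)
    · exact hne s (by omega)
  · rw [if_pos (show s ≤ d by omega), withCliques_pair_adj]
    split_ifs with h3
    · rw [hr.adj_iff_of_lt (by omega) (by omega), memA s (by omega), memA t h3, memB s (by omega),
        memB t h3]
      omega
    · have := hne s (by omega)
      rw [memA s (by omega), memB s (by omega)]
      simp only [ne_eq, this, not_false_eq_true, true_and, hξ.1, hξ.2, and_true]
      constructor
      · rintro (h4 | h4)
        · by_contra hcon
          exact adjξ s (by omega) (by omega) h4
        · omega
      · intro h4
        right
        omega

/-- Two parametrizations of the same cycle differ by a rotation or by a reflection. -/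
theorem CycParam.exists_eq_shift_or_flip (hr : CycParam R n r) (hs : Function.Surjective r)
    (hr' : CycParam R n r') (hn : 3 ≤ n) :
    ∃ k : ℕ, k < n ∧ ((∀ t : ℕ, t ≤ n → r' t = r (k + t)) ∨
      (∀ t : ℕ, t ≤ n → r' t = r (k - t))) := by
  obtain ⟨r'', -, -, hg, c, hc⟩ := hr.exists_eq_of_path hs (g := fun t : ℕ => r' t) (d := n)
    (fun t _ => by simpa using hr'.adj_succ t)
    (fun t _ => hr'.ne (by push_cast; omega) (by push_cast; omega))
  obtain ⟨k, hk, hkc⟩ := hr.exists_lt (by omega) 0 c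
  rw [zero_add, hr.eq_iff] at hkc
  refine ⟨k, hk, ?_⟩
  rcases hc with rfl | rfl
  · left
    intro t ht
    rw [← hg t ht, eq_comm, hr.eq_iff]
    ring_nf at hkc ⊢
    exact hkc
  · right
    intro t ht
    rw [← hg t ht, eq_comm, hr.eq_iff]
    ring_nf at hkc ⊢
    exact hkc

/-- Two disjoint arcs between two disjoint cliques close up through the cliques to a hole, provided
no rim edge joins them. The second arc is given by its positions `q 0, …, q d'` in the order in
which the hole meets them. -/
theorem even_of_two_arcs (h : IsArc R n (A ∪ B) r d) (hdisj : ∀ v, v ∈ A → v ∉ B) (h0 : r 0 ∈ A)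
    (hd : r d ∈ B) (hd' : 0 < d') {q : ℕ → ℕ} {l : ℕ}
    (hq : (∀ j ≤ d', q j = l + j) ∨ (∀ j ≤ d', q j + j = l))
    (hqd : ∀ j ≤ d', d < q j) (hqn : ∀ j ≤ d', q j < n)
    (hqA : ∀ j ≤ d', (r (q j) ∈ A ↔ j = d')) (hqB : ∀ j ≤ d', (r (q j) ∈ B ↔ j = 0))
    (hnr : ∀ s ≤ d, ∀ j ≤ d', ¬ R.Adj (r s) (r (q j)))
    (hfree : OddHoleFree (withCliques R {A, B})) : Even (d + d') := by
  by_contra hev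
  rw [Nat.not_even_iff_odd] at hev
  have hr := h.param
  have hpos := h.pos
  have hlt := h.lt
  have hd1 := hqd 0 (by omega)
  have hn1 := hqn 0 (by omega)
  have hqn' := hqn d' le_rfl
  have hqd' := hqd d' le_rfl
  have memA : ∀ t : ℕ, t ≤ d → (r t ∈ A ↔ t = 0) := fun t ht => by
    constructor
    · intro h1
      by_contra h2
      rcases ht.lt_or_eq with h3 | rfl
      · exact h.inner t (Nat.pos_of_ne_zero h2) h3 (Or.inl h1)
      · exact hdisj _ h1 hd
    · rintro rfl
      simpa using h0
  have memB : ∀ t : ℕ, t ≤ d → (r t ∈ B ↔ t = d) := fun t ht => by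
    constructor
    · intro h1
      by_contra h2
      rcases Nat.eq_zero_or_pos t with rfl | h3
      · exact hdisj _ h0 (by simpa using h1)
      · exact h.inner t h3 (lt_of_le_of_ne ht h2) (Or.inr h1)
    · rintro rfl
      exact hd
  have qinj : ∀ i j, i < j → j ≤ d' → (q j < q i ∧ (q i = q j + 1 ↔ j = i + 1)) ∨
      (q i < q j ∧ (q j = q i + 1 ↔ j = i + 1)) := fun i j hij hj => by
    rcases hq with hq | hq
    · have h1 := hq i (by omega)
      have h2 := hq j hj
      omega
    · have h1 := hq i (by omega)
      have h2 := hq j hj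
      omega
  have hodd : Odd (d + d' + 2) := by simpa [Nat.odd_add] using hev
  refine hfree (d + d' + 2) (by rw [Nat.odd_iff] at hev; omega) hodd (cycleGraph_isIndContained_of
    (g := fun t => if t ≤ d then r t else r (q (t - d - 1))) (fun s t h1 h2 => ?_)
      fun s t h1 h2 => ?_)
  · split_ifs with h3 h4 h4
    · exact hr.ne (by omega) (by omega)
    · have h5 := hqd (t - d - 1) (by omega)
      have h6 := hqn (t - d - 1) (by omega)
      exact hr.ne (by omega) (by omega)
    · omega
    · have h5 := qinj (s - d - 1) (t - d - 1) (by omega) (by omega)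
      have h6 := hqn (t - d - 1) (by omega)
      have h7 := hqn (s - d - 1) (by omega)
      rcases h5 with h5 | h5
      · exact (hr.ne (by omega) (by omega)).symm
      · exact hr.ne (by omega) (by omega)
  · rw [withCliques_pair_adj]
    split_ifs with h3 h4 h4
    · rw [hr.adj_iff_of_lt (by omega) (by omega), memA s h3, memA t h4, memB s h3, memB t h4]
      omega
    · have h5 := hqd (t - d - 1) (by omega)
      have h6 := hqn (t - d - 1) (by omega)
      have h7 := hnr s h3 (t - d - 1) (by omega)
      have h8 := hr.ne (s := s) (t := q (t - d - 1)) (by omega) (by omega)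
      rw [memA s h3, memB s h3, hqA _ (by omega), hqB _ (by omega)]
      simp only [h7, h8, ne_eq, not_false_eq_true, true_and, false_or]
      omega
    · omega
    · have h5 := qinj (s - d - 1) (t - d - 1) (by omega) (by omega)
      have h6 := hqn (t - d - 1) (by omega)
      have h7 := hqn (s - d - 1) (by omega)
      have h8 := hqd (t - d - 1) (by omega)
      have h9 := hqd (s - d - 1) (by omega)
      rw [hqA _ (by omega), hqB _ (by omega), hqA _ (by omega), hqB _ (by omega)]
      rcases h5 with h5 | h5
      · rw [SimpleGraph.adj_comm, hr.adj_iff_of_lt (by omega) (by omega)]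
        omega
      · rw [hr.adj_iff_of_lt (by omega) (by omega)]
        omega

/-- Two arcs between disjoint cliques `A` and `B` that share no endpoint have lengths of the same
parity. -/
theorem parity_eq_of_ne_ends (hS : CliqueSystem R F) (hA : A ∈ F) (hB : B ∈ F)
    (hdisj : ∀ v, v ∈ A → v ∉ B)
    (hoddA : ∀ r d, IsArc R n A r d → r 0 ∈ A → r d ∈ A → Odd d)
    (hoddB : ∀ r d, IsArc R n B r d → r 0 ∈ B → r d ∈ B → Odd d)
    (hfree : OddHoleFree (withCliques R {A, B}))
    (h : IsArc R n (A ∪ B) r d) (h0 : r 0 ∈ A) (hd : r d ∈ B)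
    (h' : IsArc R n (A ∪ B) r' d') (h0' : r' 0 ∈ A) (hd' : r' d' ∈ B)
    (hne0 : r 0 ≠ r' 0) (hned : r d ≠ r' d') : d % 2 = d' % 2 := by
  have hr := h.param
  have hpos := h.pos
  have hlt := h.lt
  have hpos' := h'.pos
  have hlt' := h'.lt
  have per : ∀ t : ℤ, r (n + t) = r t := fun t => by rw [add_comm]; exact hr.add_period t
  have hrn : r n = r 0 := by simpa using per 0
  have hn3 : 3 ≤ n := by
    by_contra hcon
    obtain rfl : d = 1 := by omega
    obtain rfl : d' = 1 := by omega
    obtain rfl : n = 2 := by omega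
    obtain ⟨p, hp, hpv⟩ := hr.exists_nat (by omega) h.surj (r' 0)
    obtain rfl | rfl : p = 0 ∨ p = 1 := by omega
    · exact hne0 (by simpa using hpv)
    · exact hdisj _ h0' (by rw [← hpv]; exact hd)
  obtain ⟨k, hkn, hk⟩ := hr.exists_eq_shift_or_flip h.surj h'.param hn3
  have hr0 : r' 0 = r k := by
    rcases hk with hk | hk
    · simpa using hk 0 (by omega)
    · simpa using hk 0 (by omega)
  have hkA : r k ∈ A := hr0 ▸ h0'
  have hk0 : k ≠ 0 := fun e => hne0 (by rw [hr0, e]; rfl)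
  have hdk : d < k := by
    by_contra hle
    rcases (not_lt.1 hle).lt_or_eq with h1 | h1
    · exact h.inner k (by omega) h1 (Or.inl hkA)
    · exact hdisj _ hkA (h1 ▸ hd)
  rcases hk with hk | hk
  · -- both arcs run from `A` to `B` in the same direction
    have hk' : ∀ t : ℕ, t ≤ n → r' t = r (k + t : ℕ) := fun t ht => by rw [hk t ht]; push_cast; rfl
    have hkd : k + d' < n := by
      by_contra hle
      have h1 : r' (n - k : ℕ) = r 0 := by
        rw [hk' _ (by omega), show k + (n - k) = n by omega, hrn]
      rcases (show n - k ≤ d' by omega).lt_or_eq with h2 | h2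
      · exact h'.inner (n - k) (by omega) h2 (Or.inl (h1 ▸ h0))
      · rw [h2] at h1
        exact hdisj _ h0 (h1 ▸ hd')
    have inA : ∀ j ≤ d', (r (k + j : ℕ) ∈ A ↔ j = 0) := fun j hj => by
      rw [← hk' j (by omega)]
      constructor
      · intro h1
        by_contra h2
        rcases hj.lt_or_eq with h3 | rfl
        · exact h'.inner j (by omega) h3 (Or.inl h1)
        · exact hdisj _ h1 hd'
      · rintro rfl
        exact h0'
    have inB : ∀ j ≤ d', (r (k + j : ℕ) ∈ B ↔ j = d') := fun j hj => by
      rw [← hk' j (by omega)]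
      constructor
      · intro h1
        by_contra h2
        rcases Nat.eq_zero_or_pos j with rfl | h3
        · exact hdisj _ h0' h1
        · exact h'.inner j h3 (by omega) (Or.inr h1)
      · rintro rfl
        exact hd'
    -- if a rim edge joins the two arcs, both have even length
    by_cases hc1 : k = d + 1
    · have o1 := hoddA r k ⟨hr, h.surj, by omega, hkn, fun t h1 h2 h3 => by
        rcases (show t ≤ d by omega).lt_or_eq with h4 | rfl
        · exact h.inner t h1 h4 (Or.inl h3)
        · exact hdisj _ h3 hd⟩ h0 hkA
      have o2 := hoddB _ _ (hr.isArc h.surj (S := B) (i := d) (j := k + d') (by omega) (by omega)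
        fun t h1 h2 h3 => by
          obtain ⟨j, rfl⟩ : ∃ j, t = k + j := ⟨t - k, by omega⟩
          have := (inB j (by omega)).1 h3
          omega) (by simpa using hd) (by
            rw [show (d : ℤ) + (k + d' - d : ℕ) = (k + d' : ℕ) by omega]
            exact (inB d' le_rfl).2 rfl)
      rw [Nat.odd_iff] at o1 o2
      omega
    by_cases hc2 : k + d' + 1 = n
    · have o1 := hoddA _ _ (hr.isArc h.surj (S := A) (i := k) (j := n) (by omega) (by omega)
        fun t h1 h2 h3 => by
          obtain ⟨j, rfl⟩ : ∃ j, t = k + j := ⟨t - k, by omega⟩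
          have := (inA j (by omega)).1 h3
          omega) (by simpa using hkA) (by
            rw [show (k : ℤ) + (n - k : ℕ) = n by omega, hrn]
            exact h0)
      have o2 := hoddB _ _ (hr.isArc h.surj (S := B) (i := k + d') (j := n + d) (by omega)
        (by omega) fun t h1 h2 h3 => by
          obtain ⟨j, rfl⟩ : ∃ j, t = n + j := ⟨t - n, by omega⟩
          push_cast at h3
          rw [per] at h3
          rcases Nat.eq_zero_or_pos j with rfl | h4
          · exact hdisj _ h0 (by simpa using h3)
          · exact h.inner j h4 (by omega) (Or.inr h3)) (by
            simpa only [add_zero] using (inB d' le_rfl).2 rfl) (by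
            rw [show ((k + d' : ℕ) : ℤ) + (n + d - (k + d') : ℕ) = n + d by omega, per]
            exact hd)
      rw [Nat.odd_iff] at o1 o2
      omega
    have := even_of_two_arcs h hdisj h0 hd hpos' (q := fun j => k + d' - j) (l := k + d')
      (Or.inr fun j hj => by omega) (fun j hj => by omega) (fun j hj => by omega)
      (fun j hj => by
        rw [show k + d' - j = k + (d' - j) by omega, inA _ (by omega)]
        omega)
      (fun j hj => by
        rw [show k + d' - j = k + (d' - j) by omega, inB _ (by omega)]
        omega)
      (fun s hs j hj h1 => by
        have := (hr.adj_iff_of_lt (by omega) (by omega)).1 h1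
        omega) hfree
    rw [Nat.even_iff] at this
    omega
  · -- the two arcs run from `A` to `B` in opposite directions
    have hdk' : d + d' < k := by
      by_contra hle
      have h1 : r' (k - d : ℕ) = r d := by
        rw [hk _ (by omega)]
        congr 1
        omega
      rcases (show k - d ≤ d' by omega).lt_or_eq with h2 | h2
      · exact h'.inner (k - d) (by omega) h2 (Or.inr (h1 ▸ hd))
      · rw [h2] at h1
        exact hned h1.symm
    have hk' : ∀ t : ℕ, t ≤ d' → r' t = r (k - t : ℕ) := fun t ht => by
      rw [hk t (by omega), Nat.cast_sub (by omega)]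
    have inA : ∀ j ≤ d', (r (k - j : ℕ) ∈ A ↔ j = 0) := fun j hj => by
      rw [← hk' j hj]
      constructor
      · intro h1
        by_contra h2
        rcases hj.lt_or_eq with h3 | rfl
        · exact h'.inner j (by omega) h3 (Or.inl h1)
        · exact hdisj _ h1 hd'
      · rintro rfl
        exact h0'
    have inB : ∀ j ≤ d', (r (k - j : ℕ) ∈ B ↔ j = d') := fun j hj => by
      rw [← hk' j hj]
      constructor
      · intro h1
        by_contra h2
        rcases Nat.eq_zero_or_pos j with rfl | h3
        · exact hdisj _ h0' h1
        · exact h'.inner j h3 (by omega) (Or.inr h1)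
      · rintro rfl
        exact hd'
    have hkd : r (k - d' + 0 : ℕ) ∈ B := (inB d' le_rfl).2 rfl
    have := even_of_two_arcs h hdisj h0 hd hpos' (q := fun j => k - d' + j) (l := k - d')
      (Or.inl fun j hj => rfl) (fun j hj => by omega) (fun j hj => by omega)
      (fun j hj => by
        rw [show k - d' + j = k - (d' - j) by omega, inA _ (by omega)]
        omega)
      (fun j hj => by
        rw [show k - d' + j = k - (d' - j) by omega, inB _ (by omega)]
        omega)
      (fun s hs j hj h1 => by
        rcases (hr.adj_iff_of_lt (by omega) (by omega)).1 h1 with h2 | h2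
        · obtain rfl : s = d := by omega
          obtain rfl : j = 0 := by omega
          exact hS.indep B hB _ hd _ hkd h1
        · obtain rfl : s = 0 := by omega
          refine hS.indep A hA _ h0 _ hkA ?_
          rwa [show k - d' + j = k by omega] at h1) hfree
    rw [Nat.even_iff] at this
    omega

/-- Between a `P`-mark and a later `Q`-mark there is a consecutive pair of this kind. -/
theorem exists_switch {P Q : ℕ → Prop} {p q : ℕ} (hpq : p < q) (hp : P p) (hq : Q q) :
    ∃ i j, p ≤ i ∧ i < j ∧ j ≤ q ∧ P i ∧ Q j ∧ ∀ t, i < t → t < j → ¬ P t ∧ ¬ Q t := by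
  suffices H : ∀ k p q, q - p ≤ k → p < q → P p → Q q →
      ∃ i j, p ≤ i ∧ i < j ∧ j ≤ q ∧ P i ∧ Q j ∧ ∀ t, i < t → t < j → ¬ P t ∧ ¬ Q t from
    H _ p q le_rfl hpq hp hq
  intro k
  induction k with
  | zero => intros; omega
  | succ k ih =>
    intro p q hk hpq hp hq
    by_cases hx : ∀ t, p < t → t < q → ¬ P t ∧ ¬ Q t
    · exact ⟨p, q, le_rfl, hpq, le_rfl, hp, hq, hx⟩
    · push Not at hx
      obtain ⟨t, h1, h2, h3⟩ := hx
      by_cases hPt : P t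
      · obtain ⟨i, j, h4, h5, h6, h7⟩ := ih t q (by omega) h2 hPt hq
        exact ⟨i, j, by omega, h5, h6, h7⟩
      · obtain ⟨i, j, h4, h5, h6, h7⟩ := ih p t (by omega) h1 hp (h3 hPt)
        exact ⟨i, j, h4, h5, by omega, h7⟩

/-- Two arcs between disjoint cliques `A` and `B` that start at the same vertex of `A` have lengths
of the same parity as well: a third arc, provided by further vertices of `A` and `B`, shares no
endpoint with either of them. -/
theorem parity_eq_of_eq_start (hS : CliqueSystem R F) (hA : A ∈ F) (hB : B ∈ F)
    (hdisj : ∀ v, v ∈ A → v ∉ B)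
    (hoddA : ∀ r d, IsArc R n A r d → r 0 ∈ A → r d ∈ A → Odd d)
    (hoddB : ∀ r d, IsArc R n B r d → r 0 ∈ B → r d ∈ B → Odd d)
    (hfree : OddHoleFree (withCliques R {A, B}))
    (h : IsArc R n (A ∪ B) r d) (h0 : r 0 ∈ A) (hd : r d ∈ B)
    (h' : IsArc R n (A ∪ B) r' d') (hd' : r' d' ∈ B)
    (he : r 0 = r' 0) : d % 2 = d' % 2 := by
  have h0' : r' 0 ∈ A := he ▸ h0
  have hr := h.param
  have hpos := h.pos
  have hlt := h.lt
  have hpos' := h'.pos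
  have hlt' := h'.lt
  have hrn : r n = r 0 := by simpa using hr.add_period 0
  have hA3 := hS.three_le A hA
  have hB3 := hS.three_le B hB
  -- a set with three elements leaves any two given vertices
  have third : ∀ S : Set V, 3 ≤ S.ncard → ∀ u v, ∃ w ∈ S, w ≠ u ∧ w ≠ v := by
    intro S hS3 u v
    by_contra! hcon
    have h1 : S ⊆ {u, v} := fun w hw => by
      by_cases hwu : w = u
      · exact Or.inl hwu
      · exact Or.inr (hcon w hw hwu)
    have h2 := Set.ncard_le_ncard h1 (by simp)
    have h3 := Set.ncard_insert_le u {v}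
    rw [Set.ncard_singleton] at h3
    omega
  have hn3 : 3 ≤ n := by
    by_contra hcon
    obtain rfl : n = 2 := by omega
    obtain ⟨w, -, h1, h2⟩ := third A hA3 (r 0) (r 1)
    obtain ⟨p, hp, rfl⟩ := hr.exists_nat (by omega) h.surj w
    obtain rfl | rfl : p = 0 ∨ p = 1 := by omega
    · exact h1 rfl
    · exact h2 rfl
  obtain ⟨k, hkn, hk⟩ := hr.exists_eq_shift_or_flip h.surj h'.param hn3
  have hr0 : r' 0 = r k := by
    rcases hk with hk | hk
    · simpa using hk 0 (by omega)
    · simpa using hk 0 (by omega)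
  obtain rfl : k = 0 := by
    have := hr.eq_of_eq (s := 0) (t := k) (he.trans hr0) (by omega) (by omega)
    omega
  rcases hk with hk | hk
  · -- arcs in the same direction coincide
    simp only [Nat.cast_zero, zero_add] at hk
    rcases lt_trichotomy d d' with h1 | h1 | h1
    · exact absurd (Or.inr (by rw [hk d (by omega)]; exact hd)) (h'.inner d hpos h1)
    · rw [h1]
    · exact absurd (Or.inr (by rw [← hk d' (by omega)]; exact hd')) (h.inner d' hpos' h1)
  have hk' : ∀ t : ℕ, t ≤ n → r' t = r (n - t : ℕ) := fun t ht => by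
    rw [hk t ht, ← hr.add_period, Nat.cast_sub ht]
    congr 1
    push_cast
    ring
  have hmid : d ≤ n - d' := by
    by_contra hcon
    refine h.inner (n - d') (by omega) (by omega) (Or.inr ?_)
    rw [← hk' d' (by omega)]
    exact hd'
  -- all further vertices of `A` and `B` lie strictly between the two arcs
  have mid : ∀ p : ℕ, p < n → r p ∈ A ∪ B → r p ≠ r 0 → r p ≠ r d → r p ≠ r' d' →
      d < p ∧ p < n - d' := by
    intro p hp hpS h1 h2 h3
    have hp0 : p ≠ 0 := fun e => h1 (by rw [e]; rfl)
    have hpd : p ≠ d := fun e => h2 (by rw [e])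
    have hpd' : p ≠ n - d' := fun e => h3 (by rw [hk' d' (by omega), e])
    constructor
    · by_contra hcon
      exact h.inner p (by omega) (by omega) hpS
    · by_contra hcon
      refine h'.inner (n - p) (by omega) (by omega) ?_
      rwa [hk' _ (by omega), show n - (n - p) = p by omega]
  obtain ⟨b, hb, hb1, hb2⟩ := third B hB3 (r d) (r' d')
  obtain ⟨p, hpn, rfl⟩ := hr.exists_nat (by omega) h.surj b
  obtain ⟨hp1, hp2⟩ := mid p hpn (Or.inr hb) (fun e => hdisj _ (e ▸ h0) hb) hb1 hb2
  obtain ⟨a, ha, ha1, -⟩ := third A hA3 (r 0) (r 0)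
  obtain ⟨q, hqn, rfl⟩ := hr.exists_nat (by omega) h.surj a
  obtain ⟨hq1, hq2⟩ := mid q hqn (Or.inl ha) ha1 (fun e => hdisj _ ha (e ▸ hd))
    (fun e => hdisj _ ha (e ▸ hd'))
  obtain ⟨r'', d'', h'', ha'', hb'', h1, h2, h3⟩ : ∃ r'' d'', IsArc R n (A ∪ B) r'' d'' ∧
      r'' 0 ∈ A ∧ r'' d'' ∈ B ∧ r 0 ≠ r'' 0 ∧ r d ≠ r'' d'' ∧ r' d' ≠ r'' d'' := by
    have hrd : r' d' = r (n - d' : ℕ) := hk' d' (by omega)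
    rcases Nat.lt_or_ge q p with hqp | hqp
    · obtain ⟨i, j, h1, h2, h3, h4, h5, h6⟩ := exists_switch (P := fun t : ℕ => r t ∈ A)
        (Q := fun t : ℕ => r t ∈ B) hqp ha hb
      have e : (i : ℤ) + (j - i : ℕ) = j := by omega
      refine ⟨_, _, hr.isArc h.surj (S := A ∪ B) h2 (by omega) fun t h7 h8 h9 =>
        h9.elim (h6 t h7 h8).1 (h6 t h7 h8).2, by simpa using h4, by rw [e]; exact h5, ?_, ?_, ?_⟩
      · simpa using hr.ne (s := 0) (t := i) (by omega) (by omega)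
      · rw [e]
        exact hr.ne (by omega) (by omega)
      · rw [e, hrd]
        exact (hr.ne (by omega) (by omega)).symm
    · have hqp : p < q := lt_of_le_of_ne hqp fun e => hdisj _ ha (e ▸ hb)
      obtain ⟨i, j, h1, h2, h3, h4, h5, h6⟩ := exists_switch (P := fun t : ℕ => r t ∈ B)
        (Q := fun t : ℕ => r t ∈ A) hqp hb ha
      have e : (i : ℤ) + (j - i : ℕ) = j := by omega
      refine ⟨_, _, (hr.isArc h.surj (S := A ∪ B) h2 (by omega) fun t h7 h8 h9 =>
        h9.elim (h6 t h7 h8).2 (h6 t h7 h8).1).reverse, ?_, ?_, ?_, ?_, ?_⟩ <;>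
        simp only [sub_zero, sub_self, add_zero, e]
      · exact h5
      · exact h4
      · exact hr.ne (s := 0) (t := j) (by omega) (by omega)
      · exact hr.ne (by omega) (by omega)
      · rw [hrd]
        exact (hr.ne (by omega) (by omega)).symm
  rw [parity_eq_of_ne_ends hS hA hB hdisj hoddA hoddB hfree h h0 hd h'' ha'' hb'' h1 h2,
    parity_eq_of_ne_ends hS hA hB hdisj hoddA hoddB hfree h' h0' hd' h'' ha'' hb''
      (he ▸ h1) h3]

/-- Two cliques have a common vertex. Otherwise all arcs between them have lengths of the same
parity, and summing up the lengths of all arcs around the rim shows that the rim is even. -/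
theorem exists_mem_mem_of_oddHoleFree (hS : CliqueSystem R F) (hr : CycParam R n r)
    (hs : Function.Surjective r) (hn : Odd n) (hA : A ∈ F) (hB : B ∈ F)
    (hfA : OddHoleFree (withCliques R {A})) (hfB : OddHoleFree (withCliques R {B}))
    (hfree : OddHoleFree (withCliques R {A, B})) : ∃ v, v ∈ A ∧ v ∈ B := by
  classical
  by_contra! hdisj
  have hpos := hn.pos
  have hA3 := hS.three_le A hA
  have hB3 := hS.three_le B hB
  have hoddA : ∀ r d, IsArc R n A r d → r 0 ∈ A → r d ∈ A → Odd d := fun r d h h0 hd =>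
    h.odd_of_oddHoleFree hS hA h0 hd hfA
  have hoddB : ∀ r d, IsArc R n B r d → r 0 ∈ B → r d ∈ B → Odd d := fun r d h h0 hd =>
    h.odd_of_oddHoleFree hS hB h0 hd hfB
  have hsame : ∀ r d r' d', IsArc R n (A ∪ B) r d → r 0 ∈ A → r d ∈ B → IsArc R n (A ∪ B) r' d' →
      r' 0 ∈ A → r' d' ∈ B → d % 2 = d' % 2 := by
    intro r d r' d' h h0 hd h' h0' hd'
    by_cases e0 : r 0 = r' 0
    · exact parity_eq_of_eq_start hS hA hB hdisj hoddA hoddB hfree h h0 hd h' hd' e0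
    by_cases ed : r d = r' d'
    · have hrev := h.reverse
      have hrev' := h'.reverse
      rw [Set.union_comm] at hrev hrev'
      exact parity_eq_of_eq_start hS hB hA (fun v h1 h2 => hdisj v h2 h1) hoddB hoddA
        (by rwa [Set.pair_comm]) hrev (by simpa using hd) (by simpa using h0) hrev'
        (by simpa using h0') (by simpa using ed)
    · exact parity_eq_of_ne_ends hS hA hB hdisj hoddA hoddB hfree h h0 hd h' h0' hd' e0 ed
  obtain ⟨τ, hτ⟩ : ∃ τ, ∀ r d, IsArc R n (A ∪ B) r d → r 0 ∈ A → r d ∈ B → d % 2 = τ := by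
    by_cases hex : ∃ r d, IsArc R n (A ∪ B) r d ∧ r 0 ∈ A ∧ r d ∈ B
    · obtain ⟨r, d, h, h0, hd⟩ := hex
      exact ⟨d % 2, fun r' d' h' h0' hd' => hsame r' d' r d h' h0' hd' h h0 hd⟩
    · exact ⟨0, fun r d h h0 hd => absurd ⟨r, d, h, h0, hd⟩ hex⟩
  obtain ⟨a, ha⟩ := Set.nonempty_of_ncard_ne_zero (s := A) (by omega)
  obtain ⟨c, rfl⟩ := hs a
  obtain ⟨r, hr, hs, h0⟩ : ∃ r', CycParam R n r' ∧ Function.Surjective r' ∧ r' 0 ∈ A :=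
    ⟨_, hr.shift c, CycParam.surjective_shift hs c, by simpa using ha⟩
  have h0B : r 0 ∉ B := hdisj _ h0
  have hrn : r n = r 0 := by simpa using hr.add_period 0
  have evenA := even_add_meets hr hs hpos hA3 hoddA h0 le_rfl (by rwa [hrn])
  have hBodd : Odd B.ncard := by
    obtain ⟨b, hb⟩ := Set.nonempty_of_ncard_ne_zero (s := B) (by omega)
    obtain ⟨c, rfl⟩ := hs b
    have hr' := hr.shift c
    have hs' := CycParam.surjective_shift hs c
    have := even_add_meets hr' hs' hpos hB3 hoddB (by simpa using hb) le_rfl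
      (by simpa [hr.add_period] using hb)
    rw [meets_period hr' hs' hpos, Nat.even_iff] at this
    rw [Nat.odd_iff] at hn ⊢
    omega
  -- `g` is constant at the vertices of `A ∪ B`; its values after no turn and one turn differ
  let g : ℕ → ℕ := fun t => (t + meets r A t + meets r B t + if r t ∈ B then τ + 1 else 0) % 2
  have key := const_of_consecutive (P := fun t : ℕ => r t ∈ A ∪ B) (g := g) (N := n) ?_ 0 n
    (Nat.zero_le n) le_rfl (Or.inl h0) (Or.inl (by rwa [hrn]))
  · have e1 : g 0 = 0 := by simp [g, meets_zero, h0B]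
    have e2 : g n = (n + meets r A n + meets r B n) % 2 := by simp [g, hrn, h0B]
    rw [e1, e2, meets_period hr hs hpos (A := B)] at key
    rw [Nat.even_iff] at evenA
    rw [Nat.odd_iff] at hBodd
    omega
  · intro i j hij hj hi hjm hin
    have hlt : j < i + n := by
      by_contra hge
      obtain rfl : i = 0 := by omega
      obtain rfl : j = n := by omega
      have : meets r B j = meets r B 0 := meets_eq_of_forall (Nat.zero_le _) fun t _ h2 => by
        rcases Nat.eq_zero_or_pos t with rfl | h3
        · exact h0B
        · exact fun h4 => hin t h3 h2 (Or.inr h4)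
      rw [meets_period hr hs hpos, meets_zero] at this
      omega
    have e : (i : ℤ) + (j - i : ℕ) = j := by omega
    have arc := hr.isArc hs hij hlt hin
    have same : ∀ C : Set V, r i ∉ C → C ⊆ A ∪ B → meets r C j = meets r C i := fun C h1 h2 =>
      meets_eq_of_forall hij.le fun t h3 h4 => by
        rcases h3.eq_or_lt with rfl | h3
        · exact h1
        · exact fun h5 => hin t h3 h4 (h2 h5)
    have more : ∀ C : Set V, r i ∈ C → C ⊆ A ∪ B → meets r C j = meets r C i + 1 :=
      fun C h1 h2 => meets_eq_succ hij h1 fun t h3 h4 h5 => hin t h3 h4 (h2 h5)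
    have subA : A ⊆ A ∪ B := Set.subset_union_left
    have subB : B ⊆ A ∪ B := Set.subset_union_right
    rcases hi with hi | hi <;> rcases hjm with hj' | hj'
    · have h1 := hoddA _ _ (arc.mono subA) (by simpa using hi) (by rw [e]; exact hj')
      have h2 := more A hi subA
      have h3 := same B (hdisj _ hi) subB
      rw [Nat.odd_iff] at h1
      simp only [g, if_neg (hdisj _ hi), if_neg (hdisj _ hj')]
      omega
    · have h1 := hτ _ _ arc (by simpa using hi) (by rw [e]; exact hj')
      have h2 := more A hi subA
      have h3 := same B (hdisj _ hi) subB
      simp only [g, if_neg (hdisj _ hi), if_pos hj']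
      omega
    · have h1 := hτ _ _ arc.reverse (by simpa only [sub_zero, e] using hj')
        (by simpa only [sub_self, add_zero] using hi)
      have h2 := more B hi subB
      have h3 := same A (fun h => hdisj _ h hi) subA
      simp only [g, if_pos hi, if_neg (hdisj _ hj')]
      omega
    · have h1 := hoddB _ _ (arc.mono subB) (by simpa using hi) (by rw [e]; exact hj')
      have h2 := more B hi subB
      have h3 := same A (fun h => hdisj _ h hi) subA
      rw [Nat.odd_iff] at h1
      simp only [g, if_pos hi, if_pos hj']
      omega

/-- Pairwise intersecting cliques have a common vertex, for three of them without one would contain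
a triangle that lies in no clique. -/
theorem CliqueSystem.exists_common (hS : CliqueSystem R F) (hne : F.Nonempty)
    (hpair : ∀ A ∈ F, ∀ B ∈ F, ∃ v, v ∈ A ∧ v ∈ B) : ∃ ξ, ∀ A ∈ F, ξ ∈ A := by
  obtain ⟨A, hA⟩ := hne
  by_cases hB : ∃ B ∈ F, B ≠ A
  · obtain ⟨B, hB, hBA⟩ := hB
    obtain ⟨ξ, hξA, hξB⟩ := hpair A hA B hB
    refine ⟨ξ, fun C hC => by_contra fun hξC => ?_⟩
    obtain ⟨x, hxC, hxA⟩ := hpair C hC A hA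
    obtain ⟨y, hyC, hyB⟩ := hpair C hC B hB
    have hxξ : x ≠ ξ := fun e => hξC (e ▸ hxC)
    have hyξ : y ≠ ξ := fun e => hξC (e ▸ hyC)
    have hxy : x ≠ y := by
      rintro rfl
      exact hBA (hS.linear B hB A hA x ξ hxξ hyB hxA hξB hξA)
    exact hξC (hS.mem_of_adj hC hxy hxC hyC (Or.inr ⟨hxξ, A, hA, hxA, hξA⟩)
      (Or.inr ⟨hyξ, B, hB, hyB, hξB⟩))
  · push Not at hB
    have := hS.three_le A hA
    obtain ⟨ξ, hξ⟩ := Set.nonempty_of_ncard_ne_zero (s := A) (by omega)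
    exact ⟨ξ, fun C hC => (hB C hC).symm ▸ hξ⟩

theorem exists_strongArcConditions_of_oddHoleFree (hS : CliqueSystem R F) (hne : F.Nonempty)
    (hr : CycParam R n r) (hs : Function.Surjective r) (hn : Odd n)
    (hfree : ∀ F' ⊆ F, F'.Nonempty → OddHoleFree (withCliques R F')) :
    ∃ ξ, StrongArcConditions R n F ξ := by
  have free1 : ∀ A ∈ F, OddHoleFree (withCliques R {A}) := fun A hA =>
    hfree _ (Set.singleton_subset_iff.2 hA) (Set.singleton_nonempty A)
  have free2 : ∀ A ∈ F, ∀ B ∈ F, OddHoleFree (withCliques R {A, B}) := fun A hA B hB =>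
    hfree _ (Set.insert_subset hA (Set.singleton_subset_iff.2 hB)) (Set.insert_nonempty A {B})
  obtain ⟨ξ, hξ⟩ := hS.exists_common hne fun A hA B hB => exists_mem_mem_of_oddHoleFree hS hr hs hn
    hA hB (free1 A hA) (free1 B hB) (free2 A hA B hB)
  obtain ⟨c, hc⟩ := hs ξ
  obtain ⟨r, hr, hs, h0⟩ : ∃ r', CycParam R n r' ∧ Function.Surjective r' ∧ r' 0 = ξ :=
    ⟨_, hr.shift c, CycParam.surjective_shift hs c, by simpa using hc⟩
  have hodd : ∀ A ∈ F, ∀ r d, IsArc R n A r d → r 0 ∈ A → r d ∈ A → Odd d := fun A hA r d h h0 hd =>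
    h.odd_of_oddHoleFree hS hA h0 hd (free1 A hA)
  have hinter : ∀ A ∈ F, ∀ B ∈ F, A ≠ B → A ∩ B = {ξ} := fun A hA B hB hAB => by
    refine Set.eq_singleton_iff_unique_mem.2 ⟨⟨hξ A hA, hξ B hB⟩, fun v hv => ?_⟩
    by_contra hne
    exact hAB (hS.linear A hA B hB v ξ hne hv.1 hv.2 (hξ A hA) (hξ B hB))
  refine ⟨ξ, hodd, fun A hA => ?_, hξ, hinter, fun A hA B hB hAB r d h h0 hd h0ξ hdξ =>
    h.even_of_oddHoleFree hS hA hB (hinter A hA B hB hAB) h0 hd h0ξ hdξ (free2 A hA B hB)⟩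
  have h0A : r 0 ∈ A := h0 ▸ hξ A hA
  have := even_add_meets hr hs hn.pos (hS.three_le A hA) (hodd A hA) h0A le_rfl
    (by rwa [show r n = r 0 by simpa using hr.add_period 0])
  rw [meets_period hr hs hn.pos, Nat.even_iff] at this
  rw [Nat.odd_iff] at hn ⊢
  omega

theorem IsMultisun.isHOHFree_iff_isSunoid {V : Type*} [Fintype V] {G : SimpleGraph V}
    (hG : IsMultisun G) : IsHOHFree G ↔ IsSunoid G := by
  have hS := hG.cliqueSystem
  obtain ⟨r, hr, hs⟩ := hG.exists_param
  rw [hG.isSunoid_iff, IsHOHFree, hG.hereditarily_iff]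
  constructor
  · rintro ⟨-, h⟩
    exact exists_strongArcConditions_of_oddHoleFree hS hG.exists_inscribed hr hs hG.odd_card h
  · rintro ⟨ξ, h⟩
    refine ⟨hG, fun F hF hne m hm hodd ⟨φ⟩ => ?_⟩
    obtain ⟨f, hf, -⟩ := cycleGraph_embedding_param (by omega) φ
    exact (h.mono hF).not_odd_hole (hS.mono hF) hne hr hs hG.odd_card.pos hm hodd hf

end Necessity

/-! ### Words and skeletons -/

section Words

/-- Whether a symbol differs from `ε`. -/
def Letter.notEps : Letter → Bool
  | Letter.eps => false
  | _ => true

/-- Whether a symbol is the letter with number `k`. -/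
def Letter.isLetter (k : ℕ) : Letter → Bool
  | Letter.letter j => j == k
  | _ => false

theorem Letter.isLetter_iff {k : ℕ} {x : Letter} : x.isLetter k = true ↔ x = Letter.letter k := by
  cases x <;> simp [Letter.isLetter]

/-- The pattern of a word and the word itself have the same symbols other than `ε`. -/
theorem filter_pattern (w : List Letter) :
    (pattern w).filter Letter.notEps = w.filter Letter.notEps := by
  have key : ∀ x w, (consReduce x w).filter Letter.notEps = (x :: w).filter Letter.notEps := by
    intro x w
    rcases x with _ | _ | k <;> rcases w with _ | ⟨_ | _ | j, w⟩ <;>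
      simp [consReduce, Letter.notEps]
  induction w with
  | nil => rfl
  | cons x w ih =>
    change (consReduce x (pattern w)).filter _ = _
    rw [key, List.filter_cons, ih, ← List.filter_cons]

theorem isRotated_filter {α : Type*} {l l' : List α} (p : α → Bool) (h : l.IsRotated l') :
    (l.filter p).IsRotated (l'.filter p) := by
  obtain ⟨k, hk, rfl⟩ := List.isRotated_iff_mod.1 h
  rw [List.rotate_eq_drop_append_take hk, List.filter_append]
  conv_lhs => rw [← List.take_append_drop k l, List.filter_append]
  exact List.isRotated_append

/-- A rotation of a filtered word that starts with `x` lifts to a rotation of the word that starts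
with `x`. -/
theorem exists_isRotated_of_filter {α : Type*} {l u : List α} {x : α} {p : α → Bool}
    (h : (l.filter p).IsRotated (x :: u)) :
    ∃ t, l.IsRotated (x :: t) ∧ (x :: t).filter p = x :: u := by
  obtain ⟨k, hk, hk'⟩ := List.isRotated_iff_mod.1 h
  rw [List.rotate_eq_drop_append_take hk] at hk'
  obtain ⟨l₁, l₂, rfl, h1, h2⟩ :=
    List.filter_eq_append_iff.1 (List.take_append_drop k (l.filter p)).symm
  have h3 : (l₂ ++ l₁).filter p = x :: u := by rw [List.filter_append, h1, h2, hk']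
  obtain ⟨m₁, m₂, h4, h5, h6, h7⟩ := List.filter_eq_cons_iff.1 h3
  refine ⟨m₂ ++ m₁, ?_, ?_⟩
  · refine (List.isRotated_append (l := l₁) (l' := l₂)).trans ?_
    rw [h4]
    exact List.isRotated_append (l := m₁) (l' := x :: m₂)
  · have h8 : m₁.filter p = [] := List.filter_eq_nil_iff.2 h5
    rw [List.filter_cons_of_pos h6, List.filter_append, h7, h8, List.append_nil]

/-- The counterpart for words of the interlacing of cliques. -/
def InterlacedWord (l : List Letter) : Prop :=
  ∀ x y : ℕ, x ≠ y → ∀ p q p' q', l = p ++ Letter.letter x :: q → l = p' ++ Letter.letter y :: q' →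
    Odd (p.countP (Letter.isLetter y) + p'.countP (Letter.isLetter x))

theorem countP_filter_notEps (y : ℕ) (l : List Letter) :
    (l.filter Letter.notEps).countP (Letter.isLetter y) = l.countP (Letter.isLetter y) := by
  rw [List.countP_filter]
  congr 1
  funext x
  cases x <;> simp [Letter.isLetter, Letter.notEps]

/-- Interlacing does not depend on the symbols `ε`. -/
theorem interlacedWord_filter (l : List Letter) :
    InterlacedWord (l.filter Letter.notEps) ↔ InterlacedWord l := by
  constructor
  · intro h x y hxy p q p' q' h1 h2
    have h3 := h x y hxy (p.filter Letter.notEps) (q.filter Letter.notEps)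
      (p'.filter Letter.notEps) (q'.filter Letter.notEps)
      (by rw [h1, List.filter_append, List.filter_cons_of_pos rfl])
      (by rw [h2, List.filter_append, List.filter_cons_of_pos rfl])
    rwa [countP_filter_notEps, countP_filter_notEps] at h3
  · intro h x y hxy p q p' q' h1 h2
    have lift : ∀ (z : ℕ) (p q : List Letter), l.filter Letter.notEps = p ++ Letter.letter z :: q →
        ∃ P Q, l = P ++ Letter.letter z :: Q ∧ P.filter Letter.notEps = p := by
      intro z p q hz
      obtain ⟨l₁, l₂, rfl, h3, h4⟩ := List.filter_eq_append_iff.1 hz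
      obtain ⟨m₁, m₂, rfl, h5, -, -⟩ := List.filter_eq_cons_iff.1 h4
      refine ⟨l₁ ++ m₁, m₂, by rw [List.append_assoc], ?_⟩
      rw [List.filter_append, h3, List.filter_eq_nil_iff.2 h5, List.append_nil]
    obtain ⟨P, Q, h3, h4⟩ := lift x p q h1
    obtain ⟨P', Q', h5, h6⟩ := lift y p' q' h2
    have h7 := h x y hxy P Q P' Q' h3 h5
    rwa [← countP_filter_notEps y P, ← countP_filter_notEps x P', h4, h6] at h7

/-- The word of the values of `g` at `0, …, n - 1`. -/
def wordOf {α : Type*} (g : ℤ → α) (n : ℕ) : List α :=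
  (List.range n).map fun k : ℕ => g (k : ℤ)

theorem wordOf_reverse {α : Type*} {g : ℤ → α} {n : ℕ} (hg : ∀ s t, (n : ℤ) ∣ t - s → g s = g t) :
    (wordOf g n).reverse = wordOf (fun t => g (-1 - t)) n := by
  refine List.ext_getElem (by simp [wordOf]) fun k h1 h2 => ?_
  simp only [wordOf, List.length_reverse, List.length_map, List.length_range] at h1
  simp only [wordOf, List.getElem_reverse, List.getElem_map, List.getElem_range, List.length_map,
    List.length_range]
  refine hg _ _ ⟨-1, ?_⟩
  omega

theorem wordOf_rotate {α : Type*} {g : ℤ → α} {n : ℕ} (hg : ∀ s t, (n : ℤ) ∣ t - s → g s = g t)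
    (c : ℕ) : (wordOf g n).rotate c = wordOf (fun t => g (c + t)) n := by
  refine List.ext_getElem (by simp [wordOf]) fun k h1 h2 => ?_
  simp only [wordOf, List.getElem_rotate, List.getElem_map, List.getElem_range, List.length_map,
    List.length_range]
  refine hg _ _ ?_
  push_cast
  rw [add_comm (c : ℤ)]
  exact Int.dvd_self_sub_emod

theorem wordOf_eq_append {α : Type*} (g : ℤ → α) {n p : ℕ} (hp : p < n) :
    ∃ q, wordOf g n = wordOf g p ++ g p :: q := by
  obtain ⟨k, rfl⟩ : ∃ k, n = p + 1 + k := ⟨n - (p + 1), by omega⟩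
  refine ⟨(List.range k).map fun j => g ((p + 1 + j : ℕ) : ℤ), ?_⟩
  simp [wordOf, List.range_add, List.range_succ, Function.comp_def]

theorem eq_of_wordOf_eq_append {α : Type*} {g : ℤ → α} {n : ℕ} {l q : List α} {x : α}
    (h : wordOf g n = l ++ x :: q) : l.length < n ∧ g l.length = x ∧ l = wordOf g l.length := by
  have hlt : l.length < n := by
    have := congrArg List.length h
    simp only [wordOf, List.length_map, List.length_range, List.length_append,
      List.length_cons] at this
    omega
  obtain ⟨q', hq'⟩ := wordOf_eq_append g hlt
  rw [hq'] at h
  have h1 := List.append_inj h (by simp [wordOf])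
  exact ⟨hlt, (List.cons.inj h1.2).1, h1.1.symm⟩

variable {V : Type*} {n : ℕ} {F : Set (Set V)} {A : Set V} {r : ℤ → V} {g : ℤ → Letter}

theorem meets_eq_countP {x : ℕ} (hg0 : g 0 = Letter.sigma) (h0 : r 0 ∈ A)
    (h : ∀ k : ℕ, 0 < k → k < n → (r k ∈ A ↔ g k = Letter.letter x)) {p : ℕ} (hp : p < n) :
    0 < p → meets r A p = 1 + (wordOf g p).countP (Letter.isLetter x) := by
  induction p with
  | zero => intro h; omega
  | succ p ih =>
    intro _
    rcases Nat.eq_zero_or_pos p with rfl | hp0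
    · rw [meets_succ_of_mem (by simpa using h0), meets_zero]
      simp [wordOf, hg0, Letter.isLetter]
    · have h1 := h p hp0 (by omega)
      have h2 : wordOf g (p + 1) = wordOf g p ++ [g p] := by simp [wordOf, List.range_succ]
      rw [h2, List.countP_append, List.countP_singleton]
      by_cases h3 : r p ∈ A
      · rw [meets_succ_of_mem h3, ih (by omega) hp0, if_pos (Letter.isLetter_iff.2 (h1.1 h3))]
        ring
      · rw [meets_succ_of_notMem h3, ih (by omega) hp0,
          if_neg fun h4 => h3 (h1.2 (Letter.isLetter_iff.1 h4))]
        ring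

/-- Interlacing of the cliques can be read off from the labels met along the rim. -/
theorem interlaced_iff_interlacedWord {name : Set V → ℕ} (hname : Set.InjOn name F)
    (hmem : ∀ A ∈ F, r 0 ∈ A) (hg0 : g 0 = Letter.sigma)
    (h : ∀ k : ℕ, 0 < k → k < n → ∀ A ∈ F, (r k ∈ A ↔ g k = Letter.letter (name A)))
    (hletter : ∀ k x, g k = Letter.letter x → ∃ A ∈ F, name A = x) :
    Interlaced r n F ↔ InterlacedWord (wordOf g n) := by
  have count : ∀ A ∈ F, ∀ p : ℕ, 0 < p → p < n →
      meets r A p = 1 + (wordOf g p).countP (Letter.isLetter (name A)) := fun A hA p hp0 hp =>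
    meets_eq_countP hg0 (hmem A hA) (fun k h1 h2 => h k h1 h2 A hA) hp hp0
  constructor
  · intro hint x y hxy p q p' q' h1 h2
    obtain ⟨h3, h4, h5⟩ := eq_of_wordOf_eq_append h1
    obtain ⟨h6, h7, h8⟩ := eq_of_wordOf_eq_append h2
    obtain ⟨A, hA, rfl⟩ := hletter _ _ h4
    obtain ⟨B, hB, rfl⟩ := hletter _ _ h7
    have pos : ∀ (l : List Letter) (x : ℕ), g l.length = Letter.letter x → 0 < l.length :=
      fun l x hl => Nat.pos_of_ne_zero fun e => by
        rw [e, Nat.cast_zero, hg0] at hl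
        cases hl
    have hp := pos _ _ h4
    have hp' := pos _ _ h7
    have h9 := hint A hA B hB (fun e => hxy (by rw [e])) _ _ hp h3 hp' h6
      ((h _ hp h3 A hA).2 h4) ((h _ hp' h6 B hB).2 h7)
    rw [count B hB _ hp h3, count A hA _ hp' h6, ← h5, ← h8] at h9
    rw [Nat.odd_iff] at h9 ⊢
    omega
  · intro hw A hA B hB hAB p q hp0 hpn hq0 hqn hpA hqB
    obtain ⟨u, hu⟩ := wordOf_eq_append g hpn
    obtain ⟨v, hv⟩ := wordOf_eq_append g hqn
    rw [(h p hp0 hpn A hA).1 hpA] at hu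
    rw [(h q hq0 hqn B hB).1 hqB] at hv
    have h1 := hw _ _ (fun e => hAB (hname hA hB e)) _ _ _ _ hu hv
    rw [count B hB p hp0 hpn, count A hA q hq0 hqn]
    rw [Nat.odd_iff] at h1 ⊢
    omega

end Words

/-! ### The word of a multisun -/

section Labels

variable {V : Type*} {G : SimpleGraph V} {name : Set V → ℕ}

theorem canonicalLabel_eq_sigma_iff {v : V} : canonicalLabel G name v = Letter.sigma ↔
    ∃ A B, IsInscribed G A ∧ IsInscribed G B ∧ A ≠ B ∧ v ∈ A ∧ v ∈ B := by
  unfold canonicalLabel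
  split_ifs with h1 h2
  · exact iff_of_true rfl h1
  · exact iff_of_false (by simp) h1
  · exact iff_of_false (by simp) h1

theorem exists_of_canonicalLabel_eq_letter {v : V} {x : ℕ}
    (h : canonicalLabel G name v = Letter.letter x) :
    ∃ A, IsInscribed G A ∧ v ∈ A ∧ name A = x := by
  unfold canonicalLabel at h
  split_ifs at h with h1 h2
  exact ⟨_, h2.choose_spec.1, h2.choose_spec.2, Letter.letter.inj h⟩

theorem canonicalLabel_eq_letter {v : V} {A : Set V} (hA : IsInscribed G A) (hv : v ∈ A)
    (h : canonicalLabel G name v ≠ Letter.sigma) :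
    canonicalLabel G name v = Letter.letter (name A) := by
  have h1 := mt canonicalLabel_eq_sigma_iff.2 h
  unfold canonicalLabel
  have h2 : ∃ A, IsInscribed G A ∧ v ∈ A := ⟨A, hA, hv⟩
  rw [if_neg h1, dif_pos h2]
  have h3 : h2.choose = A := by
    by_contra hne
    exact h1 ⟨_, _, h2.choose_spec.1, hA, hne, h2.choose_spec.2, hv⟩
  rw [h3]

variable [Fintype V]

/-- For a multisun whose inscribed cliques pairwise meet in the one vertex `ξ`, interlacing of the
cliques is a property of the word read from `ξ`. -/
theorem interlaced_iff_of_sunflower {r : ℤ → V}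
    (hname : Set.InjOn name {A | IsInscribed G A}) (hr : CycParam (rim G) (Fintype.card V) r)
    (hmem : ∀ A, IsInscribed G A → r 0 ∈ A)
    (hinter : ∀ A B, IsInscribed G A → IsInscribed G B → A ≠ B → A ∩ B = {r 0})
    (h0 : canonicalLabel G name (r 0) = Letter.sigma) :
    Interlaced r (Fintype.card V) {A | IsInscribed G A} ↔
      InterlacedWord (wordOf (fun t => canonicalLabel G name (r t)) (Fintype.card V)) := by
  refine interlaced_iff_interlacedWord hname hmem h0 (fun k hk0 hkn A hA => ?_) fun k x hx => ?_
  · constructor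
    · intro hkA
      refine canonicalLabel_eq_letter hA hkA fun hσ => ?_
      obtain ⟨B, C, hB, hC, hBC, h1, h2⟩ := canonicalLabel_eq_sigma_iff.1 hσ
      exact hk0.ne' (eq_zero_of_mem_mem hr (hinter B C hB hC hBC) hkn h1 h2)
    · intro hkA
      obtain ⟨B, hB, hkB, hBA⟩ := exists_of_canonicalLabel_eq_letter hkA
      rwa [← hname hB hA hBA]
  · obtain ⟨A, hA, -, hx⟩ := exists_of_canonicalLabel_eq_letter hx
    exact ⟨A, hA, hx⟩

theorem isLinearWord_iff (hV : 2 ≤ Fintype.card V) {w : List Letter} :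
    IsLinearWord G name w ↔ w.head? ≠ some Letter.eps ∧
      ∃ r, CycParam (rim G) (Fintype.card V) r ∧
        w = wordOf (fun t => canonicalLabel G name (r t)) (Fintype.card V) := by
  refine and_congr_right fun _ => ?_
  have hw : ∀ (r : ℤ → V) (φ : Fin (Fintype.card V) → V), (∀ i, r i.val = φ i) →
      (List.ofFn fun i => canonicalLabel G name (φ i)) =
        wordOf (fun t => canonicalLabel G name (r t)) (Fintype.card V) := fun r φ h => by
    refine List.ext_getElem (by simp [wordOf]) fun k h1 h2 => ?_
    simp [wordOf, ← h]
  constructor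
  · rintro ⟨φ, rfl⟩
    obtain ⟨r, hr, h⟩ := cycleGraph_embedding_param hV φ.toEmbedding
    exact ⟨r, hr, hw r φ h⟩
  · rintro ⟨r, hr, rfl⟩
    obtain ⟨φ, h⟩ := hr.embedding hV
    have hbij : Function.Bijective φ :=
      (Fintype.bijective_iff_injective_and_card φ).2 ⟨φ.injective, by simp⟩
    refine ⟨⟨Equiv.ofBijective φ hbij, φ.map_rel_iff⟩, (hw r φ fun i => (h i).symm).symm⟩

theorem mem_sWord_of_isLinearWord {w : List Letter} (h : IsLinearWord G name w) :
    w ∈ sWord G name := ⟨w, h, Or.inl (List.IsRotated.refl _)⟩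

/-- The `s`-word of a multisun with the N-conditions decides whether it is a sunoid: the interlacing
of the cliques of `H` is carried over to `G` by the words without `ε`. -/
theorem IsMultisun.isSunoid_of_sWord_eq (hG : IsMultisun G)
    (hname : Set.InjOn name {A | IsInscribed G A}) (hN : NConditions G)
    {W : Type*} [Fintype W] {H : SimpleGraph W} {name' : Set W → ℕ} (hH : IsSunoid H)
    (hname' : Set.InjOn name' {A | IsInscribed H A}) (hw : sWord G name = sWord H name') :
    IsSunoid G := by
  have hGc := hG.three_le_card
  have hHc := hH.1.three_le_card
  obtain ⟨ξ, hξ⟩ := hG.nConditions_iff.1 hN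
  obtain ⟨ζ, hζ⟩ := hH.1.isSunoid_iff.1 hH
  have hHS := hH.1.cliqueSystem
  refine hG.isSunoid_iff.2 ⟨ξ, hξ.strong hG.odd_card fun r hr hs h0 A hA B hB hAB => ?_⟩
  subst h0
  have hσ : canonicalLabel G name (r 0) = Letter.sigma :=
    canonicalLabel_eq_sigma_iff.2 ⟨A, B, hA, hB, hAB, hξ.mem A hA, hξ.mem B hB⟩
  suffices hint : Interlaced r (Fintype.card V) {A | IsInscribed G A} from hint A hA B hB hAB
  rw [interlaced_iff_of_sunflower hname hr hξ.mem (fun A B hA hB => hξ.inter A hA B hB) hσ,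
    ← interlacedWord_filter]
  -- the word of `G` read from `ξ` starts with `σ`
  set w := wordOf (fun t => canonicalLabel G name (r t)) (Fintype.card V) with hwdef
  obtain ⟨u, hu⟩ : ∃ u, w = Letter.sigma :: u := by
    obtain ⟨q, hq⟩ := wordOf_eq_append (fun t => canonicalLabel G name (r t))
      (show 0 < Fintype.card V by omega)
    rw [Nat.cast_zero, hσ] at hq
    exact ⟨q, hq⟩
  have hlin : IsLinearWord G name w :=
    (isLinearWord_iff (by omega)).2 ⟨by simp [hu], r, hr, rfl⟩
  obtain ⟨w', hw', heq⟩ := hw ▸ mem_sWord_of_isLinearWord hlin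
  obtain ⟨-, r', hr', rfl⟩ := (isLinearWord_iff (by omega)).1 hw'
  have per : ∀ r, CycParam (rim H) (Fintype.card W) r → ∀ s t, (Fintype.card W : ℤ) ∣ t - s →
      canonicalLabel H name' (r s) = canonicalLabel H name' (r t) := fun r hr s t h => by
    rw [(hr.eq_iff s t).2 h]
  -- after reversing the direction in `H` if necessary, the words without `ε` agree up to rotation
  obtain ⟨r', hr', hrot⟩ : ∃ r', CycParam (rim H) (Fintype.card W) r' ∧
      (w.filter Letter.notEps).IsRotated
        ((wordOf (fun t => canonicalLabel H name' (r' t)) (Fintype.card W)).filter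
          Letter.notEps) := by
    rcases heq with h | h
    · refine ⟨r', hr', ?_⟩
      simpa only [filter_pattern] using isRotated_filter Letter.notEps h
    · refine ⟨_, hr'.flip (-1), ?_⟩
      have h1 := (isRotated_filter Letter.notEps h).reverse
      rw [List.filter_reverse, List.reverse_reverse, filter_pattern, filter_pattern,
        ← List.filter_reverse, wordOf_reverse (per r' hr')] at h1
      exact h1
  have hwf : w.filter Letter.notEps = Letter.sigma :: u.filter Letter.notEps := by
    rw [hu, List.filter_cons_of_pos rfl]
  rw [hwf] at hrot ⊢
  obtain ⟨t, ⟨k, hk⟩, ht⟩ := exists_isRotated_of_filter hrot.symm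
  rw [wordOf_rotate (per r' hr')] at hk
  have hr'' := hr'.shift k
  set r'' : ℤ → W := fun t => r' (k + t)
  have hσ' : canonicalLabel H name' (r'' 0) = Letter.sigma :=
    (eq_of_wordOf_eq_append (l := []) hk).2.1
  have hs'' : Function.Surjective r'' := by
    obtain ⟨φ, hφ⟩ := hr''.embedding (by omega)
    intro v
    obtain ⟨i, hi⟩ := ((Fintype.bijective_iff_injective_and_card φ).2
      ⟨φ.injective, by simp⟩).2 v
    exact ⟨i.val, by rw [← hφ, hi]⟩
  obtain ⟨A', B', hA', hB', hAB', h1, h2⟩ := canonicalLabel_eq_sigma_iff.1 hσ'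
  have hζ0 : r'' 0 = ζ := by
    have h3 : r'' 0 ∈ A' ∩ B' := ⟨h1, h2⟩
    rwa [hζ.inter A' hA' B' hB' hAB'] at h3
  subst hζ0
  rw [← ht, interlacedWord_filter, ← hk, ← interlaced_iff_of_sunflower hname' hr'' hζ.mem
    (fun A B hA hB => hζ.inter A hA B hB) hσ']
  exact hζ.interlaced hHS hr'' hs'' (by omega)

end Labels

/-! ### Invariance under isomorphism -/

section Transport

variable {V W : Type*} {G : SimpleGraph V} {H : SimpleGraph W}

theorem isMaxClique_image (φ : G ≃g H) {A : Set V} (hA : IsMaxClique G A) :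
    IsMaxClique H (φ '' A) := by
  refine ⟨?_, fun B hB hAB => ?_⟩
  · rintro _ ⟨u, hu, rfl⟩ _ ⟨v, hv, rfl⟩ hne
    exact φ.map_adj_iff.2 (hA.prop hu hv fun e => hne (by rw [e]))
  · rintro b hb
    have hcl : G.IsClique (φ ⁻¹' B) := fun u hu v hv hne =>
      φ.map_adj_iff.1 (hB hu hv fun e => hne (φ.injective e))
    have := hA.le_of_ge hcl (Set.image_subset_iff.1 hAB)
    exact ⟨φ.symm b, this (by simpa using hb), by simp⟩

theorem isInscribed_image (φ : G ≃g H) {A : Set V} (hA : IsInscribed G A) :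
    IsInscribed H (φ '' A) :=
  ⟨isMaxClique_image φ hA.1, by rw [Set.ncard_image_of_injective A φ.injective]; exact hA.2⟩

theorem isInscribed_preimage (φ : G ≃g H) {B : Set W} (hB : IsInscribed H B) :
    IsInscribed G (φ ⁻¹' B) := by
  have := isInscribed_image φ.symm hB
  rwa [show φ.symm '' B = φ ⁻¹' B from φ.toEquiv.symm.image_eq_preimage_symm B] at this

theorem rim_adj_map (φ : G ≃g H) {u v : V} (h : (rim G).Adj u v) : (rim H).Adj (φ u) (φ v) :=
  ⟨fun e => h.1 (φ.injective e), by
    have := isMaxClique_image φ h.2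
    rwa [Set.image_pair] at this⟩

/-- An isomorphism of graphs is an isomorphism of their rims. -/
def rimIso (φ : G ≃g H) : rim G ≃g rim H where
  toEquiv := φ.toEquiv
  map_rel_iff' {u v} := ⟨fun h => by simpa using rim_adj_map φ.symm h, rim_adj_map φ⟩

theorem rimIso_apply (φ : G ≃g H) (v : V) : rimIso φ v = φ v := rfl

theorem CycParam.map {n : ℕ} {r : ℤ → V} (φ : G ≃g H) (h : CycParam (rim G) n r) :
    CycParam (rim H) n fun t => φ (r t) :=
  ⟨fun s t => by rw [φ.injective.eq_iff, h.eq_iff], fun s t => by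
    rw [← rimIso_apply φ, ← rimIso_apply φ, (rimIso φ).map_adj_iff, h.adj_iff]⟩

theorem IsArc.map {n d : ℕ} {r : ℤ → V} {S : Set W} (φ : G ≃g H)
    (h : IsArc (rim G) n (φ ⁻¹' S) r d) : IsArc (rim H) n S (fun t => φ (r t)) d :=
  ⟨h.param.map φ, φ.surjective.comp h.surj, h.pos, h.lt, h.inner⟩

theorem StrongArcConditions.map {n : ℕ} {ξ : V} (φ : G ≃g H)
    (h : StrongArcConditions (rim G) n {A | IsInscribed G A} ξ) :
    StrongArcConditions (rim H) n {A | IsInscribed H A} (φ ξ) := by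
  have hpre : ∀ S : Set W, φ.symm ⁻¹' (φ ⁻¹' S) = S := fun S => by ext; simp
  have hinj : ∀ A B : Set W, A ≠ B → φ ⁻¹' A ≠ φ ⁻¹' B := fun A B hAB e =>
    hAB (by rw [← hpre A, e, hpre])
  have hξ : ∀ w : W, w ≠ φ ξ → φ.symm w ≠ ξ := fun w hw e => hw (by rw [← e]; simp)
  refine ⟨fun A hA r d harc h0 hd => ?_, fun A hA => ?_, fun A hA => ?_, fun A hA B hB hAB => ?_,
    fun A hA B hB hAB r d harc h0 hd h0ξ hdξ => ?_⟩
  · exact h.odd_arc _ (isInscribed_preimage φ hA) _ d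
      (IsArc.map φ.symm (by rwa [hpre])) (by simpa using h0) (by simpa using hd)
  · have := h.odd_card _ (isInscribed_preimage φ hA)
    rwa [Set.ncard_preimage_of_injective_subset_range φ.injective (by simp)] at this
  · exact h.mem _ (isInscribed_preimage φ hA)
  · have := h.inter _ (isInscribed_preimage φ hA) _ (isInscribed_preimage φ hB) (hinj A B hAB)
    rw [← hpre (A ∩ B), Set.preimage_inter, this]
    ext w
    simp only [Set.mem_preimage, Set.mem_singleton_iff]
    exact ⟨fun e => by rw [← e]; simp, fun e => by rw [e]; simp⟩
  · exact h.even_arc _ (isInscribed_preimage φ hA) _ (isInscribed_preimage φ hB) (hinj A B hAB) _ d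
      (IsArc.map φ.symm (by rwa [← Set.preimage_union, hpre])) (by simpa using h0)
      (by simpa using hd) (hξ _ h0ξ) (hξ _ hdξ)

theorem IsMultisun.map [Fintype V] [Fintype W] (φ : G ≃g H) (h : IsMultisun G) : IsMultisun H where
  diamondFree := fun ⟨ψ⟩ => h.diamondFree ⟨φ.symm.toEmbedding.comp ψ⟩
  odd_card := Fintype.card_congr φ.toEquiv ▸ h.odd_card
  three_le_card := Fintype.card_congr φ.toEquiv ▸ h.three_le_card
  rim_cycle := by
    obtain ⟨ψ⟩ := h.rim_cycle
    rw [← Fintype.card_congr φ.toEquiv]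
    exact ⟨ψ.trans (rimIso φ)⟩
  nonconsecutive A hA u hu v hv hadj :=
    h.nonconsecutive _ (isInscribed_preimage φ hA) (φ.symm u) (by simpa using hu) (φ.symm v)
      (by simpa using hv) (rim_adj_map φ.symm hadj)
  exists_inscribed := h.exists_inscribed.imp' (φ '' ·) fun _ => isInscribed_image φ

theorem IsSunoid.map [Fintype V] [Fintype W] (φ : G ≃g H) (h : IsSunoid G) : IsSunoid H := by
  obtain ⟨ξ, hξ⟩ := h.1.isSunoid_iff.1 h
  refine (h.1.map φ).isSunoid_iff.2 ⟨φ ξ, ?_⟩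
  rw [← Fintype.card_congr φ.toEquiv]
  exact hξ.map φ

theorem canonicalLabel_map (φ : G ≃g H) {name : Set V → ℕ} {name' : Set W → ℕ}
    (hn : ∀ B, name' B = name (φ ⁻¹' B)) (v : V) :
    canonicalLabel H name' (φ v) = canonicalLabel G name v := by
  have hn' : ∀ A, name' (φ '' A) = name A := fun A => by
    rw [hn, Set.preimage_image_eq A φ.injective]
  have hσ : canonicalLabel H name' (φ v) = Letter.sigma ↔
      canonicalLabel G name v = Letter.sigma := by
    rw [canonicalLabel_eq_sigma_iff, canonicalLabel_eq_sigma_iff]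
    constructor
    · rintro ⟨A, B, hA, hB, hAB, h1, h2⟩
      refine ⟨_, _, isInscribed_preimage φ hA, isInscribed_preimage φ hB, fun e => hAB ?_, h1, h2⟩
      exact φ.surjective.preimage_injective e
    · rintro ⟨A, B, hA, hB, hAB, h1, h2⟩
      exact ⟨_, _, isInscribed_image φ hA, isInscribed_image φ hB,
        fun e => hAB (φ.injective.image_injective e), ⟨v, h1, rfl⟩, ⟨v, h2, rfl⟩⟩
  have hl : ∀ x, canonicalLabel H name' (φ v) = Letter.letter x ↔
      canonicalLabel G name v = Letter.letter x := by
    intro x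
    constructor
    · intro h
      obtain ⟨B, hB, hv, rfl⟩ := exists_of_canonicalLabel_eq_letter h
      rw [hn]
      exact canonicalLabel_eq_letter (isInscribed_preimage φ hB) hv
        (mt hσ.2 (by rw [h]; simp))
    · intro h
      obtain ⟨A, hA, hv, rfl⟩ := exists_of_canonicalLabel_eq_letter h
      rw [← hn']
      exact canonicalLabel_eq_letter (isInscribed_image φ hA) ⟨v, hv, rfl⟩
        (mt hσ.1 (by rw [h]; simp))
  cases h : canonicalLabel G name v with
  | sigma => exact hσ.2 h
  | letter x => exact (hl x).2 h
  | eps =>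
    cases h' : canonicalLabel H name' (φ v) with
    | sigma => rw [hσ.1 h'] at h; exact h
    | letter x => rw [(hl x).1 h'] at h; cases h
    | eps => rfl

theorem IsSunoid.isSunword [Fintype V] {name : Set V → ℕ} (h : IsSunoid G)
    (hname : Set.InjOn name {A | IsInscribed G A}) : IsSunword (sWord G name) := by
  let e := Fintype.equivFin V
  let φ : G ≃g G.map e.toEmbedding := SimpleGraph.Iso.map e G
  have hinj : Function.Injective (φ ⁻¹' ·) := φ.surjective.preimage_injective
  have hc := h.1.three_le_card
  refine ⟨_, G.map e.toEmbedding, fun B => name (φ ⁻¹' B), h.map φ, fun A hA B hB hAB =>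
    hinj (hname (isInscribed_preimage φ hA) (isInscribed_preimage φ hB) hAB), ?_⟩
  have hlin : ∀ w, IsLinearWord G name w ↔
      IsLinearWord (G.map e.toEmbedding) (fun B => name (φ ⁻¹' B)) w := by
    intro w
    rw [isLinearWord_iff (by omega), isLinearWord_iff (by rw [Fintype.card_fin]; omega),
      Fintype.card_fin]
    refine and_congr_right fun _ => ⟨?_, ?_⟩
    · rintro ⟨r, hr, rfl⟩
      refine ⟨_, hr.map φ, ?_⟩
      simp only [canonicalLabel_map φ (name := name) fun _ => rfl]
    · rintro ⟨r, hr, rfl⟩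
      refine ⟨_, hr.map φ.symm, ?_⟩
      congr 1
      funext t
      conv_lhs => rw [← φ.apply_symm_apply (r t)]
      exact canonicalLabel_map φ (fun _ => rfl) _
  simp only [sWord, hlin]

end Transport

end Multisun

theorem mainTheorem2 {V : Type*} [Fintype V] (G : SimpleGraph V) (hG : Multisun.IsMultisun G)
    (name : Set V → ℕ) (hname : Set.InjOn name {A | Multisun.IsInscribed G A}) :
    List.TFAE
      [Multisun.IsSunoid G,
       Multisun.NConditions G ∧ Multisun.IsSunword (Multisun.sWord G name),
       Multisun.IsHOHFree G] := by
  tfae_have 1 ↔ 3 := hG.isHOHFree_iff_isSunoid.symm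
  tfae_have 1 → 2 := fun h => ⟨h.2.1, h.isSunword hname⟩
  tfae_have 2 → 1 := fun ⟨hN, n, H, name', hH, hname', hw⟩ =>
    hG.isSunoid_of_sWord_eq hname hN hH hname' hw
  tfae_finish
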